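/- Let $\Bbbk$ be an algebraically closed field of characteristic $p>0$ and let $m,n\ge 0$ be integers with $m+n\ge 1$. For $1\le i\le m+n$ put $|i|=0$ if $i\le m$ and $|i|=1$ if $i>m$. Let $\mathfrak g=\mathfrak{gl}_{m|n}[x]=\mathfrak{gl}_{m|n}\otimes\Bbbk[x]$ be the current Lie superalgebra, with basis $e_{i,j}x^r:=e_{i,j}\otimes x^r$ ($1\le i,j\le m+n$, $r\ge 0$), where $e_{i,j}x^r$ has parity $|i|+|j| \pmod 2$, and with $$[e_{i,j}x^r,e_{k,l}x^s]=\delta_{k,j}\,e_{i,l}x^{r+s}-(-1)^{(|i|+|j|)(|k|+|l|)}\delta_{l,i}\,e_{k,j}x^{r+s}.$$ Let $U(\mathfrak g)$ be its universal enveloping superalgebra: the quotient of the tensor algebra of $\mathfrak g$ by the relations $ab-(-1)^{|a||b|}ba=[a,b]$ for homogeneous $a,b\in\mathfrak g$, together with the relation that the square in $U(\mathfrak g)$ of an odd $y\in\mathfrak g$ equals the square of $y$ in the associative superalgebra $\mathrm{Mat}_{m|n}(\Bbbk)\otimes\Bbbk[x]$ (automatic if $p\ne 2$; if $p=2$ it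 is part of the definition of the enveloping algebra). Let $Z(\mathfrak g)=Z(\mathfrak g)_{\bar 0}\oplus Z(\mathfrak g)_{\bar 1}$ be its center, where $$Z(\mathfrak g)_a=\{z\in U(\mathfrak g)_a:\ zy=(-1)^{ab}yz\ \text{ for all } y\in\mathfrak g_b,\ b\in\mathbb Z/2\}.$$ For $r\ge 0$ let $z_r=e_{1,1}x^r+\cdots+e_{m+n,m+n}x^r$. Let $Z_p(\mathfrak g)$, the $p$-center, be the subalgebra of $U(\mathfrak g)$ generated by all $y^p-y^{[p]}$ with $y\in\mathfrak g_{\bar 0}$, where $y^{[p]}$ is the $p$-th power of $y$ in $\mathrm{Mat}_{m|n}(\Bbbk)\otimes\Bbbk[x]$, so that $(ax^r)^{[p]}=a^px^{rp}$ for $a\in\mathfrak{gl}_m\oplus\mathfrak{gl}_n$. **Theorem.** The center $Z(\mathfrak g)$ of $U(\mathfrak g)$ is generated, as an algebra, by $\{z_r : r\ge 0\}$ and $Z_p(\mathfrak g)$. In fact, $Z(\mathfrak g)$ is freely generated, as a commutative algebra, by $$\{z_r : r\ge 0\}\cup\{(e_{i,j}x^r)^p-\delta_{i,j}\,e_{i,j}x^{rp}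 : 1\le i,j\le m+n,\ (i,j)\ne(1,1),\ r\ge 0,\ |i|+|j|\equiv 0 \bmod 2\}.$$ -/

import Mathlib

open scoped TensorProduct

noncomputable section

namespace SuperCurrent

/-- The parity `|i|` of an index: `0` for the first `m` indices, `1` for the last `n`. -/
def parity (m n : ℕ) (i : Fin (m + n)) : ZMod 2 := if i.val < m then 0 else 1

/-- The current superalgebra `gl_{m|n}[x] = gl_{m|n} ⊗ k[x]` as a vector space. Its `*` is the
product of the associative superalgebra `Mat_{m|n}(k) ⊗ k[x]`. -/
abbrev Cur (k : Type*) [Field k] (m n : ℕ) : Type _ :=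
  Matrix (Fin (m + n)) (Fin (m + n)) k ⊗[k] Polynomial k

section Current

variable (k : Type*) [Field k] (m n : ℕ)

/-- The basis element `e_{i,j} x^r = e_{i,j} ⊗ x^r`. -/
def e (i j : Fin (m + n)) (r : ℕ) : Cur k m n :=
  Matrix.single i j (1 : k) ⊗ₜ[k] (Polynomial.X ^ r : Polynomial k)

/-- The homogeneous part `gl_{m|n}[x]_a`, `a ∈ ℤ/2`. -/
def part (a : ZMod 2) : Submodule k (Cur k m n) :=
  Submodule.span k {x | ∃ i j r, parity m n i + parity m n j = a ∧ x = e k m n i j r}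

/-- The projection of a matrix to its part of parity `a`. -/
def matProj (a : ZMod 2) :
    Matrix (Fin (m + n)) (Fin (m + n)) k →ₗ[k] Matrix (Fin (m + n)) (Fin (m + n)) k where
  toFun A := Matrix.of fun i j => if parity m n i + parity m n j = a then A i j else 0
  map_add' A B := by
    ext i j
    by_cases h : parity m n i + parity m n j = a <;> simp [h]
  map_smul' c A := by
    ext i j
    by_cases h : parity m n i + parity m n j = a <;> simp [h]

/-- The projection `x ↦ x_a` of `gl_{m|n}[x]` to its part of parity `a`. -/
def proj (a : ZMod 2) : Cur k m n →ₗ[k] Cur k m n :=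
  LinearMap.rTensor (Polynomial k) (matProj k m n a)

/-- The sign `(-1)^{ab}`. -/
def sgn (a b : ZMod 2) : k := (-1) ^ (a.val * b.val)

variable {k m n}

/-- The Lie superbracket: the bilinear map with `[x, y] = x y - (-1)^{ab} y x` for `x` of parity
`a` and `y` of parity `b`. -/
def bracket (x y : Cur k m n) : Cur k m n :=
  ∑ a : ZMod 2, ∑ b : ZMod 2,
    (proj k m n a x * proj k m n b y - sgn k a b • (proj k m n b y * proj k m n a x))

theorem proj_e (a : ZMod 2) (i j : Fin (m + n)) (r : ℕ) :
    proj k m n a (e k m n i j r) =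
      if parity m n i + parity m n j = a then e k m n i j r else 0 := by
  have h : matProj k m n a (Matrix.single i j (1 : k)) =
      if parity m n i + parity m n j = a then Matrix.single i j (1 : k) else 0 := by
    ext i' j'
    by_cases h1 : i = i' <;> by_cases h2 : j = j' <;>
      by_cases h3 : parity m n i + parity m n j = a <;>
      simp_all [matProj, Matrix.single]
  unfold proj e
  rw [LinearMap.rTensor_tmul, h]
  split_ifs <;> simp

theorem e_mul_e (i j i' j' : Fin (m + n)) (r s : ℕ) :
    e k m n i j r * e k m n i' j' s = if j = i' then e k m n i j' (r + s) else 0 := by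
  unfold e
  rw [Algebra.TensorProduct.tmul_mul_tmul, ← pow_add]
  split_ifs with h
  · subst h; simp
  · simp [Matrix.single_mul_single_of_ne _ _ _ _ h]

/-- The defining supercommutation relations on the basis. -/
theorem bracket_e (i j i' j' : Fin (m + n)) (r s : ℕ) :
    bracket (e k m n i j r) (e k m n i' j' s) =
      (if i' = j then e k m n i j' (r + s) else 0) -
        sgn k (parity m n i + parity m n j) (parity m n i' + parity m n j') •
          (if j' = i then e k m n i' j (r + s) else 0) := by
  unfold bracket
  rw [Finset.sum_eq_single (parity m n i + parity m n j),
    Finset.sum_eq_single (parity m n i' + parity m n j')]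
  · simp only [proj_e, if_true, e_mul_e, add_comm s r, eq_comm]
  · intro b _ hb
    simp [proj_e, hb.symm]
  · simp
  · intro a _ ha
    simp [proj_e, ha.symm]
  · simp

theorem proj_of_mem {a : ZMod 2} {x : Cur k m n} (hx : x ∈ part k m n a) (b : ZMod 2) :
    proj k m n b x = if a = b then x else 0 := by
  induction hx using Submodule.span_induction with
  | mem x h =>
    obtain ⟨i, j, r, h, rfl⟩ := h
    rw [proj_e, h]
  | zero => simp
  | add x y _ _ hx hy => rw [map_add, hx, hy]; split_ifs <;> simp
  | smul c x _ hx => rw [map_smul, hx]; split_ifs <;> simp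

/-- The superbracket of homogeneous elements. -/
theorem bracket_of_mem {a b : ZMod 2} {x y : Cur k m n} (hx : x ∈ part k m n a)
    (hy : y ∈ part k m n b) : bracket x y = x * y - sgn k a b • (y * x) := by
  unfold bracket
  rw [Finset.sum_eq_single a, Finset.sum_eq_single b]
  · simp [proj_of_mem hx, proj_of_mem hy]
  · intro b' _ hb
    simp [proj_of_mem hy, hb.symm]
  · simp
  · intro a' _ ha
    simp [proj_of_mem hx, ha.symm]
  · simp

/-- If `2 ≠ 0`, the supercommutation relations force the square of an odd `y` to be `y * y`. -/
theorem square_of_comm (h2 : (2 : k) ≠ 0) {A : Type*} [Ring A] [Algebra k A]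
    (f : Cur k m n →ₗ[k] A) {y : Cur k m n} (hy : y ∈ part k m n 1)
    (h : f y * f y - sgn k 1 1 • (f y * f y) = f (bracket y y)) : f y * f y = f (y * y) := by
  have hs : sgn k 1 1 = -1 := by simp [sgn, ZMod.val_one]
  have hb : y * y - (-1 : k) • (y * y) = (2 : k) • (y * y) := by
    rw [sub_eq_iff_eq_add, ← add_smul]
    norm_num
  rw [bracket_of_mem hy hy, hs, hb, map_smul, neg_one_smul, sub_neg_eq_add,
    ← two_smul k (f y * f y)] at h
  exact (smul_right_injective A h2) h

/-- The `p`-map on pure tensors. -/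
theorem tmul_X_pow (A : Matrix (Fin (m + n)) (Fin (m + n)) k) (r p : ℕ) :
    (A ⊗ₜ[k] (Polynomial.X ^ r : Polynomial k) : Cur k m n) ^ p =
      (A ^ p) ⊗ₜ[k] (Polynomial.X ^ (r * p) : Polynomial k) := by
  rw [Algebra.TensorProduct.tmul_pow, pow_mul]

end Current

section Enveloping

variable (k : Type*) [Field k] (m n : ℕ)

/-- The relations of the universal enveloping superalgebra `U(gl_{m|n}[x])`.  The relation
`square` says that the square of an odd element in `U` is its square `[y, y] / 2 = y * y` in
`gl_{m|n}[x]`. It follows from `comm` if `2 ≠ 0` in `k`; in characteristic `2` it is part of the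
definition of the enveloping algebra of a Lie superalgebra. -/
inductive Rel : TensorAlgebra k (Cur k m n) → TensorAlgebra k (Cur k m n) → Prop
  | comm (a b : ZMod 2) (x y : Cur k m n) (hx : x ∈ part k m n a) (hy : y ∈ part k m n b) :
      Rel (TensorAlgebra.ι k x * TensorAlgebra.ι k y -
            sgn k a b • (TensorAlgebra.ι k y * TensorAlgebra.ι k x))
        (TensorAlgebra.ι k (bracket x y))
  | square (y : Cur k m n) (hy : y ∈ part k m n 1) :
      Rel (TensorAlgebra.ι k y * TensorAlgebra.ι k y) (TensorAlgebra.ι k (y * y))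

/-- The universal enveloping superalgebra `U(gl_{m|n}[x])`. -/
abbrev U : Type _ := RingQuot (Rel k m n)

/-- The canonical map `gl_{m|n}[x] → U(gl_{m|n}[x])`. -/
def ι : Cur k m n →ₗ[k] U k m n :=
  (RingQuot.mkAlgHom k (Rel k m n)).toLinearMap ∘ₗ TensorAlgebra.ι k

/-- The homogeneous part `U(gl_{m|n}[x])_a`: the span of the monomials in the `e_{i,j} x^r` of
total parity `a`. -/
def UPart (a : ZMod 2) : Submodule k (U k m n) :=
  Submodule.span k {u | ∃ l : List (Fin (m + n) × Fin (m + n) × ℕ),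
    (l.map fun t => parity m n t.1 + parity m n t.2.1).sum = a ∧
      u = (l.map fun t => ι k m n (e k m n t.1 t.2.1 t.2.2)).prod}

/-- `Z_a = {z ∈ U_a ; z x = (-1)^{ab} x z for all b and all x ∈ gl_{m|n}[x]_b}`. -/
def centerPart (a : ZMod 2) : Submodule k (U k m n) where
  carrier := {z | z ∈ UPart k m n a ∧ ∀ b : ZMod 2, ∀ x ∈ part k m n b,
    z * ι k m n x = sgn k a b • (ι k m n x * z)}
  zero_mem' := ⟨zero_mem _, by simp⟩
  add_mem' := by
    rintro z w ⟨hz, hz'⟩ ⟨hw, hw'⟩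
    refine ⟨add_mem hz hw, fun b x hx => ?_⟩
    rw [add_mul, mul_add, smul_add, hz' b x hx, hw' b x hx]
  smul_mem' := by
    rintro c z ⟨hz, hz'⟩
    refine ⟨Submodule.smul_mem _ c hz, fun b x hx => ?_⟩
    rw [smul_mul_assoc, hz' b x hx, mul_smul_comm, smul_comm]

/-- The center `Z = Z_0 ⊕ Z_1` of the superalgebra `U(gl_{m|n}[x])`. -/
def center : Submodule k (U k m n) := centerPart k m n 0 ⊔ centerPart k m n 1

/-- `z_r = e_{1,1} x^r + ⋯ + e_{m+n,m+n} x^r`, in `U(gl_{m|n}[x])`. -/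
def z (r : ℕ) : U k m n := ι k m n (∑ i, e k m n i i r)

/-- The `p`-center: the subalgebra generated by all `x^p - x^{[p]}` with `x` even. The `p`-map
`x ↦ x^{[p]}` of the even part `(gl_m ⊕ gl_n) ⊗ k[x]` is the `p`-th power in
`Mat_{m|n}(k) ⊗ k[x]`; in particular `(a x^r)^{[p]} = a^p x^{rp}`. -/
def pCenter (p : ℕ) : Subalgebra k (U k m n) :=
  Algebra.adjoin k {u | ∃ x ∈ part k m n 0, u = ι k m n x ^ p - ι k m n (x ^ p)}

/-- The index set of the free generators: `r ≥ 0` for `z_r`, and the triples `(i, j, r)` with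
`e_{i,j}` even and `(i, j)` not the pair of first indices. -/
abbrev GenIndex (m n : ℕ) : Type :=
  ℕ ⊕ {t : Fin (m + n) × Fin (m + n) × ℕ //
    parity m n t.1 + parity m n t.2.1 = 0 ∧ ¬(t.1.val = 0 ∧ t.2.1.val = 0)}

/-- The free generators `z_r` and `(e_{i,j} x^r)^p - δ_{i,j} e_{i,j} x^{rp}`. -/
def gen (p : ℕ) : GenIndex m n → U k m n
  | Sum.inl r => z k m n r
  | Sum.inr ⟨(i, j, r), _⟩ =>
      ι k m n (e k m n i j r) ^ p - if i = j then ι k m n (e k m n i j (r * p)) else 0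

end Enveloping

end SuperCurrent

end

noncomputable section

set_option linter.unusedSectionVars false

namespace SuperCurrent

/-! ### Signs of the parity pairing. -/

section Sign

variable (k : Type*) [Field k]

/-! The associative product of `Mat ⊗ k[x]` makes the supersymmetric algebra `S` of `g =
gl_{m|n}[x]` a `U(g)`-module: `x` acts as multiplication by `x` plus the superderivation extending
`y ↦ x y`. Applying `u` to the unit gives a symbol map `U(g) → S` which, unlike symmetrization,
needs no division by factorials. It takes ordered monomials to monomials plus terms of lower degree,
so it is injective (`symb_injective`, a form of PBW). Right multiplication by `x` turns, up to sign,
into multiplication by `x` plus the superderivation extending `y ↦ ± y x` (`rep_mul_ι`). Hence the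
symbol `f` of a central element is an invariant: the two superderivations agree on it
(`der_eq_of_mem_centerPart`).

Upper bound. Test invariance against `e_{i,j} x^s` with `s` larger than every power of `x` occurring
in `f`, and compare the coefficients of variables too high to occur in `f` (`D_relation`). All
off-diagonal derivatives of `f` vanish, and the diagonal ones with the same power of `x` coincide.
So `f` has no odd variables, and once `z_r` replaces `e_{1,1} x^r` as a coordinate, only the
derivatives along the `z_r` can be nonzero. In characteristic `p` this makes `f` a polynomial in the
`z_r` and the `p`-th powers of the other even variables (`mem_range_invMap`).

Lower bound. The `z_r` and the `y^p - y^{[p]}` are central. By a case of Jacobson's formula, `y^p -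
y^{[p]}` acts on `S` exactly as the `p`-th power of multiplication by `y` (`rep_pow_sub`), while
`z_r` acts as multiplication plus a derivation that sends `z_s` to `z_{r+s}` and commutes with
multiplication by the `p`-th powers. The symbols of polynomials in the proposed generators are
therefore triangular with respect to the polynomials found in the upper bound, and span the same
space (`symbHom_injective_and_range`). Together with injectivity of the symbol map this yields both
generation and freeness. -/

theorem zmod_two_cases (a : ZMod 2) : a = 0 ∨ a = 1 := by
  revert a; decide

@[simp] theorem sgn_zero_left (a : ZMod 2) : sgn k 0 a = 1 := by simp [sgn]

@[simp] theorem sgn_zero_right (a : ZMod 2) : sgn k a 0 = 1 := by simp [sgn]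

@[simp] theorem sgn_one_one : sgn k 1 1 = -1 := by simp [sgn, ZMod.val_one]

theorem sgn_symm (a b : ZMod 2) : sgn k a b = sgn k b a := by simp [sgn, mul_comm]

theorem sgn_add_left (a b c : ZMod 2) : sgn k (a + b) c = sgn k a c * sgn k b c := by
  have h : (1 : ZMod 2) + 1 = 0 := by decide
  rcases zmod_two_cases a with rfl | rfl <;> rcases zmod_two_cases b with rfl | rfl <;>
    rcases zmod_two_cases c with rfl | rfl <;> simp [h]

theorem sgn_add_right (a b c : ZMod 2) : sgn k a (b + c) = sgn k a b * sgn k a c := by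
  rw [sgn_symm, sgn_add_left, sgn_symm k b, sgn_symm k c]

@[simp] theorem sgn_mul_self (a b : ZMod 2) : sgn k a b * sgn k a b = 1 := by
  rcases zmod_two_cases a with rfl | rfl <;> rcases zmod_two_cases b with rfl | rfl <;> simp

theorem sgn_ne_zero (a b : ZMod 2) : sgn k a b ≠ 0 := by
  intro h
  simpa [h] using sgn_mul_self k a b

end Sign

/-! ### The supersymmetric algebra: variables, derivatives and their commutation relations. -/

/-- The supersymmetric algebra on a set `I` of variables with parity `π`, as the free module over
the polynomial ring in the even variables on the finite sets of odd variables. -/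
def Fock (k : Type*) [Field k] {I : Type*} (π : I → ZMod 2) : Type _ :=
  Finset {t // π t ≠ 0} →₀ MvPolynomial {t // π t = 0} k

namespace Fock

variable {k : Type*} [Field k] {I : Type*} [DecidableEq I] [Encodable I] {π : I → ZMod 2}

instance : AddCommGroup (Fock k π) :=
  inferInstanceAs (AddCommGroup (Finset {t // π t ≠ 0} →₀ MvPolynomial {t // π t = 0} k))

instance : Module k (Fock k π) :=
  inferInstanceAs (Module k (Finset {t // π t ≠ 0} →₀ MvPolynomial {t // π t = 0} k))

/-- The polynomial multiples of the product of a finite set of odd variables. -/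
def single (F : Finset {t // π t ≠ 0}) : MvPolynomial {t // π t = 0} k →ₗ[k] Fock k π :=
  Finsupp.lsingle (M := MvPolynomial {t // π t = 0} k) (R := k) F

/-- The coefficient of the product of a finite set of odd variables. -/
def coeff (F : Finset {t // π t ≠ 0}) : Fock k π →ₗ[k] MvPolynomial {t // π t = 0} k :=
  Finsupp.lapply (M := MvPolynomial {t // π t = 0} k) (R := k) F

/-- The linear map with given restrictions to the multiples of the odd monomials. -/
def lift {N : Type*} [AddCommGroup N] [Module k N]
    (f : Finset {t // π t ≠ 0} → MvPolynomial {t // π t = 0} k →ₗ[k] N) : Fock k π →ₗ[k] N :=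
  Finsupp.lsum (M := MvPolynomial {t // π t = 0} k) (R := k) k f

@[simp] theorem lift_single {N : Type*} [AddCommGroup N] [Module k N]
    (f : Finset {t // π t ≠ 0} → MvPolynomial {t // π t = 0} k →ₗ[k] N) (F) (g) :
    lift f (single F g) = f F g :=
  Finsupp.lsum_single (M := MvPolynomial {t // π t = 0} k) (R := k) k f F g

theorem coeff_single (F G : Finset {t // π t ≠ 0}) (g : MvPolynomial {t // π t = 0} k) :
    coeff F (single G g) = if G = F then g else 0 :=
  Finsupp.single_apply

theorem ext_coeff {f g : Fock k π} (h : ∀ F, coeff F f = coeff F g) : f = g :=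
  Finsupp.ext h

theorem induction_linear {P : Fock k π → Prop} (f : Fock k π) (zero : P 0)
    (add : ∀ f g, P f → P g → P (f + g)) (single : ∀ F g, P (single F g)) : P f :=
  Finsupp.induction_linear f zero add single

/-- The number of elements of `F` that precede `u`. -/
def below (u : {t // π t ≠ 0}) (F : Finset {t // π t ≠ 0}) : ℕ :=
  (F.filter fun v => Encodable.encode v.1 < Encodable.encode u.1).card

theorem below_insert {u v : {t // π t ≠ 0}} {F : Finset {t // π t ≠ 0}} (hv : v ∉ F) :
    below u (insert v F) =
      below u F + if Encodable.encode v.1 < Encodable.encode u.1 then 1 else 0 := by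
  unfold below
  rw [Finset.filter_insert]
  split_ifs with h
  · rw [Finset.card_insert_of_notMem (by simp [hv])]
  · simp

theorem below_insert_self (u : {t // π t ≠ 0}) (F : Finset {t // π t ≠ 0}) :
    below u (insert u F) = below u F := by
  unfold below
  rw [Finset.filter_insert, if_neg (lt_irrefl _)]

theorem encode_lt_iff_not {u v : {t // π t ≠ 0}} (h : u ≠ v) :
    Encodable.encode v.1 < Encodable.encode u.1 ↔
      ¬ Encodable.encode u.1 < Encodable.encode v.1 := by
  have : Encodable.encode u.1 ≠ Encodable.encode v.1 := fun h' =>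
    h (Subtype.ext (Encodable.encode_injective h'))
  omega

/-- Multiplication by an odd variable. -/
def oddX (u : {t // π t ≠ 0}) : Module.End k (Fock k π) :=
  lift fun F => if u ∈ F then 0 else (-1 : k) ^ below u F • single (insert u F)

/-- The left derivative in an odd variable. -/
def oddD (u : {t // π t ≠ 0}) : Module.End k (Fock k π) :=
  lift fun F => if u ∈ F then (-1 : k) ^ below u F • single (F.erase u) else 0

/-- Multiplication by an even variable. -/
def evX (t : {t // π t = 0}) : Module.End k (Fock k π) :=
  lift fun F => single F ∘ₗ LinearMap.mulLeft k (MvPolynomial.X t)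

/-- The derivative in an even variable. -/
def evD (t : {t // π t = 0}) : Module.End k (Fock k π) :=
  lift fun F => single F ∘ₗ (MvPolynomial.pderiv (R := k) t).toLinearMap

theorem oddX_single (u : {t // π t ≠ 0}) (F) (g : MvPolynomial {t // π t = 0} k) :
    oddX u (single F g) =
      if u ∈ F then 0 else (-1 : k) ^ below u F • single (insert u F) g := by
  rw [oddX, lift_single]; split_ifs <;> simp

theorem oddD_single (u : {t // π t ≠ 0}) (F) (g : MvPolynomial {t // π t = 0} k) :
    oddD u (single F g) =
      if u ∈ F then (-1 : k) ^ below u F • single (F.erase u) g else 0 := by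
  rw [oddD, lift_single]; split_ifs <;> simp

theorem evX_single (t : {t // π t = 0}) (F) (g : MvPolynomial {t // π t = 0} k) :
    (evX t (single F g) : Fock k π) = single F (MvPolynomial.X t * g) := by
  simp [evX]

theorem evD_single (t : {t // π t = 0}) (F) (g : MvPolynomial {t // π t = 0} k) :
    (evD t (single F g) : Fock k π) = single F (MvPolynomial.pderiv t g) := by
  simp [evD]

theorem end_ext {f g : Module.End k (Fock k π)}
    (h : ∀ F a, f (single F a) = g (single F a)) : f = g :=
  LinearMap.ext fun s => by
    induction s using Fock.induction_linear with
    | zero => simp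
    | add f g hf hg => rw [map_add, map_add, hf, hg]
    | single F g => exact h F g

/-- For distinct `u`, `v` outside `F`, exactly one of the two precedes the other, so the two orders
of insertion give sign exponents that differ by one. -/
theorem oddX_mul_oddX (u v : {t // π t ≠ 0}) :
    (oddX u * oddX v : Module.End k (Fock k π)) = -(oddX v * oddX u) := by
  refine end_ext fun F a => ?_
  simp only [Module.End.mul_apply, LinearMap.neg_apply, oddX_single]
  by_cases huv : u = v
  · subst huv
    by_cases hu : u ∈ F <;> simp [hu, oddX_single]
  · by_cases hu : u ∈ F <;> by_cases hv : v ∈ F <;>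
      simp [hu, hv, oddX_single, huv, Ne.symm huv, below_insert,
        Finset.insert_comm u v, smul_smul, -not_lt]
    rw [← neg_smul]
    congr 1
    have := encode_lt_iff_not huv
    split_ifs <;> first | omega | ring

/-- Kept apart from anticommutation, which does not imply it in characteristic 2. -/
theorem oddX_sq (u : {t // π t ≠ 0}) : (oddX u * oddX u : Module.End k (Fock k π)) = 0 := by
  refine end_ext fun F a => ?_
  by_cases hu : u ∈ F <;> simp [Module.End.mul_apply, hu, oddX_single]

theorem oddD_mul_oddX (u v : {t // π t ≠ 0}) :
    (oddD u * oddX v : Module.End k (Fock k π)) =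
      -(oddX v * oddD u) + if u = v then 1 else 0 := by
  refine end_ext fun F a => ?_
  simp only [Module.End.mul_apply, LinearMap.neg_apply, LinearMap.add_apply, oddX_single,
    oddD_single]
  by_cases huv : u = v
  · subst huv
    by_cases hu : u ∈ F
    · have h : below u F = below u (F.erase u) := by
        conv_lhs => rw [← Finset.insert_erase hu, below_insert_self]
      simp [hu, oddX_single, h, smul_smul, ← mul_pow]
    · simp [hu, oddD_single, smul_smul, ← mul_pow, below_insert_self]
  · by_cases hu : u ∈ F
    · by_cases hv : v ∈ F
      · simp [hu, hv, oddX_single, huv, Ne.symm huv]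
      · have h1 : below u (insert v F) = _ := below_insert hv
        have h2 : below v F = below v (F.erase u) +
            if Encodable.encode u.1 < Encodable.encode v.1 then 1 else 0 := by
          rw [← below_insert (Finset.notMem_erase u F), Finset.insert_erase hu]
        simp only [hu, hv, oddX_single, oddD_single, huv, Finset.mem_insert,
          Finset.mem_erase, if_true, if_false, h1, h2, map_smul, smul_smul, or_true, and_false,
          LinearMap.zero_apply, add_zero, ← neg_smul]
        rw [Finset.erase_insert_of_ne (Ne.symm huv)]
        congr 1
        have := encode_lt_iff_not huv
        split_ifs <;> first | omega | ring
    · by_cases hv : v ∈ F <;> simp [hu, hv, oddD_single, huv]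

theorem evX_mul_evX (t u : {t // π t = 0}) :
    (evX t * evX u : Module.End k (Fock k π)) = evX u * evX t := by
  refine end_ext fun F a => ?_
  simp [Module.End.mul_apply, evX_single, mul_left_comm]

theorem evD_mul_evX (t u : {t // π t = 0}) :
    (evD t * evX u : Module.End k (Fock k π)) = evX u * evD t + if t = u then 1 else 0 := by
  refine end_ext fun F a => ?_
  by_cases h : t = u
  · subst h
    simp [Module.End.mul_apply, evX_single, evD_single, add_comm]
  · simp [Module.End.mul_apply, evX_single, evD_single, MvPolynomial.pderiv_X_of_ne (Ne.symm h), h]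

theorem evX_mul_oddX (t : {t // π t = 0}) (u : {t // π t ≠ 0}) :
    (evX t * oddX u : Module.End k (Fock k π)) = oddX u * evX t := by
  refine end_ext fun F a => ?_
  by_cases h : u ∈ F <;> simp [Module.End.mul_apply, evX_single, oddX_single, h]

theorem evX_mul_oddD (t : {t // π t = 0}) (u : {t // π t ≠ 0}) :
    (evX t * oddD u : Module.End k (Fock k π)) = oddD u * evX t := by
  refine end_ext fun F a => ?_
  by_cases h : u ∈ F <;> simp [Module.End.mul_apply, evX_single, oddD_single, h]

theorem evD_mul_oddX (t : {t // π t = 0}) (u : {t // π t ≠ 0}) :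
    (evD t * oddX u : Module.End k (Fock k π)) = oddX u * evD t := by
  refine end_ext fun F a => ?_
  by_cases h : u ∈ F <;> simp [Module.End.mul_apply, evD_single, oddX_single, h]

/-- Multiplication by a variable. -/
def X (t : I) : Module.End k (Fock k π) :=
  if h : π t = 0 then evX ⟨t, h⟩ else oddX ⟨t, h⟩

/-- The left derivative in a variable. -/
def D (t : I) : Module.End k (Fock k π) :=
  if h : π t = 0 then evD ⟨t, h⟩ else oddD ⟨t, h⟩

/-- The unit of the supersymmetric algebra. -/
def vac : Fock k π := single ∅ 1

/-- The sign operator, `s ↦ (-1)^{b|s|} s`. -/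
def sigma (b : ZMod 2) : Module.End k (Fock k π) :=
  lift fun F => (-1 : k) ^ (b.val * F.card) • single F

theorem sigma_single (b : ZMod 2) (F) (g : MvPolynomial {t // π t = 0} k) :
    sigma b (single F g : Fock k π) = (-1 : k) ^ (b.val * F.card) • single F g := by
  simp [sigma]

theorem eq_one_of_ne_zero {a : ZMod 2} (h : a ≠ 0) : a = 1 :=
  (zmod_two_cases a).resolve_left h

theorem X_mul_X (t u : I) :
    (X t * X u : Module.End k (Fock k π)) = sgn k (π t) (π u) • (X u * X t) := by
  by_cases ht : π t = 0 <;> by_cases hu : π u = 0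
  · simp [X, ht, hu, evX_mul_evX]
  · simp [X, ht, hu, evX_mul_oddX]
  · simp [X, ht, hu, evX_mul_oddX]
  · have h : sgn k (π t) (π u) = -1 := by
      rw [eq_one_of_ne_zero ht, eq_one_of_ne_zero hu, sgn_one_one]
    simp [X, ht, hu, h, oddX_mul_oddX ⟨t, ht⟩ ⟨u, hu⟩, neg_smul]

theorem X_sq {t : I} (ht : π t = 1) : (X t * X t : Module.End k (Fock k π)) = 0 := by
  have : π t ≠ 0 := by simp [ht]
  simp [X, this, oddX_sq]

/-- The Clifford–Weyl relation, uniform in the parities; the Leibniz rule for `der` is deduced from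
it. -/
theorem D_mul_X (t u : I) : (D t * X u : Module.End k (Fock k π)) =
    sgn k (π t) (π u) • (X u * D t) + if t = u then 1 else 0 := by
  by_cases ht : π t = 0 <;> by_cases hu : π u = 0
  · simp [X, D, ht, hu, evD_mul_evX]
  · have : t ≠ u := by rintro rfl; exact hu ht
    simp [X, D, ht, hu, evD_mul_oddX, this]
  · have : t ≠ u := by rintro rfl; exact ht hu
    simp [X, D, ht, hu, evX_mul_oddD, this]
  · have h : sgn k (π t) (π u) = -1 := by
      rw [eq_one_of_ne_zero ht, eq_one_of_ne_zero hu, sgn_one_one]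
    simp [X, D, ht, hu, h, oddD_mul_oddX ⟨t, ht⟩ ⟨u, hu⟩, neg_smul]

@[simp] theorem D_vac (t : I) : D t (vac : Fock k π) = 0 := by
  by_cases ht : π t = 0 <;> simp [D, ht, vac, evD_single, oddD_single]

@[simp] theorem sigma_vac (b : ZMod 2) : sigma b (vac : Fock k π) = vac := by
  simp [vac, sigma_single]

theorem sigma_mul_X (b : ZMod 2) (t : I) :
    (sigma b * X t : Module.End k (Fock k π)) = sgn k b (π t) • (X t * sigma b) := by
  by_cases ht : π t = 0
  · refine end_ext fun F a => ?_
    simp [X, ht, Module.End.mul_apply, sigma_single, evX_single]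
  · refine end_ext fun F a => ?_
    have h : sgn k b (π t) = (-1) ^ b.val := by
      rw [eq_one_of_ne_zero ht]
      simp [sgn, ZMod.val_one]
    by_cases hF : ⟨t, ht⟩ ∈ F
    · simp [X, ht, Module.End.mul_apply, sigma_single, oddX_single, hF]
    · simp [X, ht, h, Module.End.mul_apply, sigma_single, oddX_single, hF, smul_smul]
      congr 1
      ring

/-- An element involves finitely many variables. This turns the formally infinite sum that defines a
superderivation into a finite one. -/
theorem finite_D_ne_zero (f : Fock k π) : {t | D t f ≠ 0}.Finite := by
  induction f using Fock.induction_linear with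
  | zero => simp
  | add f g hf hg =>
    refine (hf.union hg).subset fun t ht => ?_
    by_contra h
    simp only [Set.mem_union, Set.mem_ofPred_eq, not_or, not_not] at h
    exact ht (by rw [map_add, h.1, h.2, add_zero])
  | single F g =>
    refine ((F.finite_toSet.image Subtype.val).union
      (g.vars.finite_toSet.image Subtype.val)).subset fun t ht => ?_
    by_contra h
    simp only [Set.mem_union, Set.mem_image, not_or, not_exists, not_and] at h
    refine ht ?_
    by_cases h0 : π t = 0
    · have := MvPolynomial.pderiv_eq_zero_of_notMem_vars (f := g) (i := ⟨t, h0⟩)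
        fun h' => h.2 ⟨t, h0⟩ h' rfl
      simp [D, h0, evD_single, this]
    · have : (⟨t, h0⟩ : {t // π t ≠ 0}) ∉ F := fun h' => h.1 ⟨t, h0⟩ h' rfl
      simp [D, h0, oddD_single, this]

/-! ### Words, the degree filtration and monomials. -/

/-- The product of the operators `X t` over a list. -/
def word (l : List I) : Module.End k (Fock k π) := (l.map X).prod

@[simp] theorem word_nil : (word [] : Module.End k (Fock k π)) = 1 := rfl

@[simp] theorem word_cons (t : I) (l : List I) :
    (word (t :: l) : Module.End k (Fock k π)) = X t * word l := by simp [word]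

variable (k π) in
/-- The elements of degree at most `d`. -/
def deg (d : ℕ) : Submodule k (Fock k π) :=
  Submodule.span k {s | ∃ l : List I, l.length ≤ d ∧ s = word l vac}

theorem word_mem_deg {l : List I} {d : ℕ} (h : l.length ≤ d) :
    (word l vac : Fock k π) ∈ deg k π d :=
  Submodule.subset_span ⟨l, h, rfl⟩

theorem deg_mono {d d' : ℕ} (h : d ≤ d') : deg k π d ≤ deg k π d' :=
  Submodule.span_mono fun _ ⟨l, hl, hs⟩ => ⟨l, hl.trans h, hs⟩

theorem X_mem_deg (t : I) {d : ℕ} {s : Fock k π} (hs : s ∈ deg k π d) :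
    X t s ∈ deg k π (d + 1) := by
  induction hs using Submodule.span_induction with
  | mem s h =>
    obtain ⟨l, hl, rfl⟩ := h
    exact Submodule.subset_span ⟨t :: l, by simpa using hl, by simp⟩
  | zero => simp
  | add x y _ _ hx hy => rw [map_add]; exact add_mem hx hy
  | smul c x _ hx => rw [map_smul]; exact Submodule.smul_mem _ c hx

/-- The multiset of the variables of a monomial. -/
def vars (b : Finset {t // π t ≠ 0} × ({t // π t = 0} →₀ ℕ)) : Multiset I :=
  b.1.val.map Subtype.val + b.2.toMultiset.map Subtype.val

/-- The monomials. -/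
def mono (b : Finset {t // π t ≠ 0} × ({t // π t = 0} →₀ ℕ)) : Fock k π :=
  single b.1 (MvPolynomial.monomial b.2 1)

theorem word_even_single (l : List {t // π t = 0}) (F) (g : MvPolynomial {t // π t = 0} k) :
    (word (l.map Subtype.val) (single F g) : Fock k π) =
      single F ((l.map MvPolynomial.X).prod * g) := by
  induction l with
  | nil => simp
  | cons t l ih =>
    simp only [List.map_cons, word_cons, Module.End.mul_apply, ih, List.prod_cons, mul_assoc]
    rw [X, dif_pos t.2, evX_single]

theorem exists_word_eq_mono (b : Finset {t // π t ≠ 0} × ({t // π t = 0} →₀ ℕ)) :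
    ∃ l : List I, (l : Multiset I) = vars b ∧ word l vac = (mono b : Fock k π) := by
  obtain ⟨F, a⟩ := b
  -- Each new odd variable precedes all those already present, so multiplying by it on the left
  -- produces no sign.
  induction F using Finset.induction_on_min_value
    (f := fun u : {t // π t ≠ 0} => Encodable.encode u.1) with
  | empty =>
    refine ⟨a.toMultiset.toList.map Subtype.val, ?_, ?_⟩
    · rw [← Multiset.map_coe, Multiset.coe_toList]
      simp [vars]
    · rw [vac, word_even_single, mul_one, mono]
      congr 1
      rw [← Multiset.prod_coe, ← Multiset.map_coe, Multiset.coe_toList, MvPolynomial.monomial_eq, map_one,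
        one_mul, Finsupp.toMultiset_map, Finsupp.prod_toMultiset,
        Finsupp.prod_mapDomain_index (fun _ => pow_zero _) (fun _ _ _ => pow_add _ _ _)]
  | insert u F hu hF ih =>
    obtain ⟨l, h1, h2⟩ := ih
    refine ⟨u.1 :: l, ?_, ?_⟩
    · rw [← Multiset.cons_coe, h1]
      simp [vars, Finset.insert_val_of_notMem hu]
    · have h3 : below u F = 0 := by
        rw [below, Finset.card_eq_zero, Finset.filter_eq_empty_iff]
        exact fun v hv => not_lt.2 (hF v hv)
      simp [h2, X, u.2, mono, oddX_single, hu, h3]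

theorem span_mono_eq_top : Submodule.span k (Set.range (mono (k := k) (π := π))) = ⊤ := by
  refine eq_top_iff.2 fun f _ => ?_
  induction f using Fock.induction_linear with
  | zero => exact zero_mem _
  | add f g hf hg => exact add_mem (hf trivial) (hg trivial)
  | single F g =>
    induction g using MvPolynomial.induction_on' with
    | monomial a c =>
      have : (single F (MvPolynomial.monomial a c) : Fock k π) = c • mono (F, a) := by
        rw [mono, ← map_smul, MvPolynomial.smul_monomial, smul_eq_mul, mul_one]
      rw [this]
      exact Submodule.smul_mem _ _ (Submodule.subset_span ⟨_, rfl⟩)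
    | add p q hp hq =>
      rw [map_add]
      exact add_mem (hp trivial) (hq trivial)

theorem exists_mem_deg (s : Fock k π) : ∃ d, s ∈ deg k π d := by
  have hs : s ∈ Submodule.span k (Set.range (mono (k := k) (π := π))) := by
    rw [span_mono_eq_top]; trivial
  induction hs using Submodule.span_induction with
  | mem s h =>
    obtain ⟨b, rfl⟩ := h
    obtain ⟨l, -, h⟩ := exists_word_eq_mono (k := k) b
    exact ⟨l.length, h ▸ word_mem_deg le_rfl⟩
  | zero => exact ⟨0, zero_mem _⟩
  | add x y _ _ hx hy =>
    obtain ⟨d, hd⟩ := hx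
    obtain ⟨d', hd'⟩ := hy
    exact ⟨max d d', add_mem (deg_mono (le_max_left _ _) hd) (deg_mono (le_max_right _ _) hd')⟩
  | smul c x _ hx =>
    obtain ⟨d, hd⟩ := hx
    exact ⟨d, Submodule.smul_mem _ c hd⟩

/-- An operator that supercommutes with the variables and kills the unit is zero. -/
theorem eq_zero_of_comm {O : Module.End k (Fock k π)} (c : I → k)
    (h : ∀ t, O * X t = c t • (X t * O)) (h0 : O vac = 0) : O = 0 := by
  refine LinearMap.ext fun s => ?_
  obtain ⟨d, hs⟩ := exists_mem_deg s
  induction hs using Submodule.span_induction with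
  | mem s hs =>
    obtain ⟨l, -, rfl⟩ := hs
    induction l with
    | nil => simpa using h0
    | cons t l ih =>
      have := LinearMap.congr_fun (h t) (word l vac)
      simp only [Module.End.mul_apply, LinearMap.smul_apply, ih, LinearMap.zero_apply, map_zero,
        smul_zero] at this
      simpa using this
  | zero => simp
  | add x y _ _ hx hy => simp [map_add, hx, hy]
  | smul c x _ hx => simp [map_smul, hx]

theorem D_mul_D (t u : I) :
    (D t * D u : Module.End k (Fock k π)) = sgn k (π t) (π u) • (D u * D t) := by
  rw [← sub_eq_zero]
  -- The supercommutator of two derivatives supercommutes with all variables, with the sign of an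
  -- operator of parity `π t + π u`, and kills the unit.
  refine eq_zero_of_comm (fun v => sgn k (π t + π u) (π v)) (fun v => ?_) (by simp)
  rw [sub_mul, smul_mul_assoc, mul_assoc, mul_assoc, D_mul_X u v, D_mul_X t v, mul_add, mul_add,
    mul_smul_comm, mul_smul_comm, ← mul_assoc, ← mul_assoc, D_mul_X t v, D_mul_X u v, mul_sub,
    mul_smul_comm, sgn_add_left, add_mul, add_mul, smul_mul_assoc, smul_mul_assoc, mul_assoc,
    mul_assoc]
  by_cases ht : t = v <;> by_cases hu : u = v
  · rw [ht, hu]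
    rcases zmod_two_cases (π v) with h | h <;> simp [h]
  · subst ht
    rcases zmod_two_cases (π t) with h | h <;> rcases zmod_two_cases (π u) with h' | h' <;>
      simp [h, h', hu] <;> module
  · subst hu
    rcases zmod_two_cases (π t) with h | h <;> rcases zmod_two_cases (π u) with h' | h' <;>
      simp [h, h', ht] <;> module
  · simp only [ht, hu, if_false, add_zero, mul_zero, zero_mul]
    module

end Fock

end SuperCurrent

/-! ### Multiplication by vectors, and superderivations extending linear maps. -/

namespace SuperCurrent

namespace Fock

variable {k : Type*} [Field k] {I : Type*} [DecidableEq I] [Encodable I] {π : I → ZMod 2}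
  {V : Type*} [AddCommGroup V] [Module k V] (e : Module.Basis I k V)

theorem mul_mul_of_mul_eq {M : Type*} [Semigroup M] {a b c : M} (h : a * b = c) (d : M) :
    a * (b * d) = c * d := by rw [← mul_assoc, h]

@[elab_as_elim]
theorem basis_induction {P : V → Prop} (v : V) (zero : P 0)
    (add : ∀ x y, P x → P y → P (x + y)) (smul : ∀ (c : k) (t : I), P (c • e t)) : P v := by
  have hv : v ∈ Submodule.span k (Set.range e) := e.mem_span v
  have h : ∀ c : k, P (c • v) := by
    induction hv using Submodule.span_induction with
    | mem v h =>
      obtain ⟨t, rfl⟩ := h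
      exact fun c => smul c t
    | zero => exact fun c => by rwa [smul_zero]
    | add x y _ _ hx hy => exact fun c => by rw [smul_add]; exact add _ _ (hx c) (hy c)
    | smul a x _ hx => exact fun c => by rw [smul_smul]; exact hx _
  simpa using h 1

/-- Multiplication by a vector. -/
def mul : V →ₗ[k] Module.End k (Fock k π) := e.constr k X

@[simp] theorem mul_basis (t : I) : (mul e (e t) : Module.End k (Fock k π)) = X t :=
  e.constr_basis k X t

variable (π) in
/-- The homogeneous part of parity `a` of the space with basis `e`. -/
def homog (a : ZMod 2) : Submodule k V := Submodule.span k {v | ∃ t, π t = a ∧ v = e t}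

theorem basis_mem_homog (t : I) : e t ∈ homog π e (π t) := Submodule.subset_span ⟨t, rfl, rfl⟩

theorem mul_mul_X {a : ZMod 2} {v : V} (hv : v ∈ homog π e a) (t : I) :
    (mul e v * X t : Module.End k (Fock k π)) = sgn k a (π t) • (X t * mul e v) := by
  induction hv using Submodule.span_induction with
  | mem v h =>
    obtain ⟨u, rfl, rfl⟩ := h
    rw [mul_basis, X_mul_X]
  | zero => simp
  | add x y _ _ hx hy => simp only [map_add, add_mul, mul_add, hx, hy, smul_add]
  | smul c x _ hx => simp only [map_smul, smul_mul_assoc, mul_smul_comm, hx, smul_comm c]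

theorem mul_mul_mul {a b : ZMod 2} {v w : V} (hv : v ∈ homog π e a) (hw : w ∈ homog π e b) :
    (mul e v * mul e w : Module.End k (Fock k π)) = sgn k a b • (mul e w * mul e v) := by
  induction hw using Submodule.span_induction with
  | mem v h =>
    obtain ⟨u, rfl, rfl⟩ := h
    rw [mul_basis, mul_mul_X e hv]
  | zero => simp
  | add x y _ _ hx hy => simp only [map_add, add_mul, mul_add, hx, hy, smul_add]
  | smul c x _ hx => simp only [map_smul, smul_mul_assoc, mul_smul_comm, hx, smul_comm c]

/-- Squares of odd variables vanish and the cross terms cancel by anticommutation, so no division by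
2 is involved. -/
theorem mul_sq {v : V} (hv : v ∈ homog π e 1) :
    (mul e v * mul e v : Module.End k (Fock k π)) = 0 := by
  induction hv using Submodule.span_induction with
  | mem v h =>
    obtain ⟨u, hu, rfl⟩ := h
    rw [mul_basis, X_sq hu]
  | zero => simp
  | add x y hx' hy' hx hy =>
    have := mul_mul_mul (k := k) e hx' hy'
    simp only [sgn_one_one, neg_smul, one_smul] at this
    simp only [map_add, add_mul, mul_add, hx, hy, this]
    abel
  | smul c x _ hx => simp only [map_smul, smul_mul_assoc, mul_smul_comm, hx, smul_zero]

theorem sigma_mul_mul (b : ZMod 2) {a : ZMod 2} {v : V} (hv : v ∈ homog π e a) :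
    (sigma b * mul e v : Module.End k (Fock k π)) = sgn k b a • (mul e v * sigma b) := by
  induction hv using Submodule.span_induction with
  | mem v h =>
    obtain ⟨u, rfl, rfl⟩ := h
    rw [mul_basis, sigma_mul_X]
  | zero => simp
  | add x y _ _ hx hy => simp only [map_add, add_mul, mul_add, hx, hy, smul_add]
  | smul c x _ hx => simp only [map_smul, smul_mul_assoc, mul_smul_comm, hx, smul_comm c]

theorem mul_mem_deg (v : V) {d : ℕ} {s : Fock k π} (hs : s ∈ deg k π d) :
    mul e v s ∈ deg k π (d + 1) := by
  induction v using basis_induction e with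
  | zero => simp
  | add x y hx hy => simpa using add_mem hx hy
  | smul c t => simpa using Submodule.smul_mem _ c (X_mem_deg t hs)

/-- Lets derivations of several elements be computed over one common finite set of variables. -/
theorem sum_eq_of_D_eq_zero (T : I → Module.End k (Fock k π)) {f : Fock k π} {G G' : Finset I}
    (h : ∀ t ∉ G, D t f = 0) (h' : ∀ t ∉ G', D t f = 0) :
    ∑ t ∈ G, T t (D t f) = ∑ t ∈ G', T t (D t f) := by
  have key : ∀ H : Finset I, (∀ t ∉ H, D t f = 0) →
      ∑ t ∈ H, T t (D t f) = ∑ t ∈ G ∪ G' ∪ H, T t (D t f) := fun H hH =>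
    Finset.sum_subset Finset.subset_union_right fun t _ ht => by rw [hH t ht, map_zero]
  rw [key G h, key G' h']
  congr 1
  ext t
  simp only [Finset.mem_union]
  tauto

/-- A finite set of variables outside which the derivatives of `f` vanish. -/
def supp (f : Fock k π) : Finset I := (finite_D_ne_zero f).toFinset

theorem D_eq_zero_of_notMem_supp {f : Fock k π} {t : I} (h : t ∉ supp f) : D t f = 0 := by
  simpa [supp] using h

/-- The left superderivation that extends an endomorphism `T` of the space of generators. -/
def der (T : Module.End k V) : Module.End k (Fock k π) where
  toFun f := ∑ t ∈ supp f, mul e (T (e t)) (D t f)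
  map_add' f g := by
    have h : ∀ t ∉ supp f ∪ supp g, D t f = 0 ∧ D t g = 0 := fun t ht => by
      rw [Finset.mem_union, not_or] at ht
      exact ⟨D_eq_zero_of_notMem_supp ht.1, D_eq_zero_of_notMem_supp ht.2⟩
    rw [sum_eq_of_D_eq_zero _ (fun t => D_eq_zero_of_notMem_supp) (fun t ht => (h t ht).1),
      sum_eq_of_D_eq_zero (f := g) _ (fun t => D_eq_zero_of_notMem_supp) (fun t ht => (h t ht).2),
      sum_eq_of_D_eq_zero (f := f + g) (G' := supp f ∪ supp g) _
        (fun t => D_eq_zero_of_notMem_supp)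
        (fun t ht => by rw [map_add, (h t ht).1, (h t ht).2, add_zero]), ← Finset.sum_add_distrib]
    simp
  map_smul' c f := by
    rw [sum_eq_of_D_eq_zero (f := c • f) (G' := supp f) _
        (fun t => D_eq_zero_of_notMem_supp)
        (fun t ht => by rw [map_smul, D_eq_zero_of_notMem_supp ht, smul_zero])]
    simp [Finset.smul_sum]

theorem der_apply (T : Module.End k V) {f : Fock k π} {G : Finset I} (h : ∀ t ∉ G, D t f = 0) :
    der e T f = ∑ t ∈ G, mul e (T (e t)) (D t f) :=
  sum_eq_of_D_eq_zero _ (fun _ => D_eq_zero_of_notMem_supp) h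

@[simp] theorem der_vac (T : Module.End k V) : der e T (vac : Fock k π) = 0 := by
  rw [der_apply e T (G := ∅) (by simp)]; simp

theorem der_add (T T' : Module.End k V) :
    (der e (T + T') : Module.End k (Fock k π)) = der e T + der e T' := by
  ext1 f
  rw [LinearMap.add_apply, der_apply e (T + T') (fun _ => D_eq_zero_of_notMem_supp (f := f)),
    der_apply e T (fun _ => D_eq_zero_of_notMem_supp (f := f)),
    der_apply e T' (fun _ => D_eq_zero_of_notMem_supp (f := f)), ← Finset.sum_add_distrib]
  simp

theorem der_smul (c : k) (T : Module.End k V) :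
    (der e (c • T) : Module.End k (Fock k π)) = c • der e T := by
  ext1 f
  rw [LinearMap.smul_apply, der_apply e (c • T) (fun _ => D_eq_zero_of_notMem_supp (f := f)),
    der_apply e T (fun _ => D_eq_zero_of_notMem_supp (f := f)), Finset.smul_sum]
  simp

variable (π) in
/-- The endomorphism `T` is homogeneous of parity `b`. -/
def IsHomog (b : ZMod 2) (T : Module.End k V) : Prop := ∀ t, T (e t) ∈ homog π e (b + π t)

variable {e}

theorem IsHomog.apply_mem {b a : ZMod 2} {T : Module.End k V} (hT : IsHomog π e b T) {v : V}
    (hv : v ∈ homog π e a) : T v ∈ homog π e (b + a) := by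
  induction hv using Submodule.span_induction with
  | mem v h =>
    obtain ⟨u, rfl, rfl⟩ := h
    exact hT u
  | zero => simp
  | add x y _ _ hx hy => rw [map_add]; exact add_mem hx hy
  | smul c x _ hx => rw [map_smul]; exact Submodule.smul_mem _ c hx

theorem IsHomog.mul {a b : ZMod 2} {T T' : Module.End k V} (hT : IsHomog π e a T)
    (hT' : IsHomog π e b T') : IsHomog π e (a + b) (T * T') := fun t => by
  rw [add_assoc]
  exact hT.apply_mem (hT' t)

theorem IsHomog.sub {a : ZMod 2} {T T' : Module.End k V} (hT : IsHomog π e a T)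
    (hT' : IsHomog π e a T') : IsHomog π e a (T - T') := fun t => sub_mem (hT t) (hT' t)

theorem IsHomog.smul {a : ZMod 2} {T : Module.End k V} (c : k) (hT : IsHomog π e a T) :
    IsHomog π e a (c • T) := fun t => Submodule.smul_mem _ c (hT t)

/-- The super Leibniz rule. Moving `D t` and then `mul e (T (e t))` past `X u` costs the signs of `π
t` and `b + π t` against `π u`; their product is the sign of `b`, and the term `t = u` leaves `T (e
u)`. -/
theorem der_mul_X {b : ZMod 2} {T : Module.End k V} (hT : IsHomog π e b T) (u : I) :
    (der e T * X u : Module.End k (Fock k π)) =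
      sgn k b (π u) • (X u * der e T) + mul e (T (e u)) := by
  ext1 f
  have h1 : ∀ t ∉ insert u (supp f), D t f = 0 := fun t ht =>
    D_eq_zero_of_notMem_supp fun h => ht (Finset.mem_insert_of_mem h)
  have h3 : ∀ t, D t (X u f) = sgn k (π t) (π u) • X u (D t f) + if t = u then f else 0 := by
    intro t
    have := LinearMap.congr_fun (D_mul_X (k := k) t u) f
    rw [Module.End.mul_apply] at this
    rw [this]
    split_ifs <;> simp
  have h2 : ∀ t ∉ insert u (supp f), D t (X u f) = 0 := fun t ht => by
    have : t ≠ u := fun h => ht (h ▸ Finset.mem_insert_self _ _)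
    rw [h3, h1 t ht, if_neg this]
    simp
  rw [Module.End.mul_apply, der_apply e T h2, LinearMap.add_apply, LinearMap.smul_apply,
    Module.End.mul_apply, der_apply e T h1, map_sum, Finset.smul_sum]
  simp only [h3, map_add, Finset.sum_add_distrib]
  congr 1
  · refine Finset.sum_congr rfl fun t _ => ?_
    have := LinearMap.congr_fun (mul_mul_X e (hT t) u) (D t f)
    simp only [Module.End.mul_apply, LinearMap.smul_apply] at this
    rw [map_smul, this, smul_smul, sgn_add_left, mul_left_comm, sgn_mul_self, mul_one]
  · rw [Finset.sum_eq_single u]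
    · simp
    · intro t _ ht
      simp [ht]
    · simp

theorem der_mul_mul {a b : ZMod 2} {T : Module.End k V} (hT : IsHomog π e b T) {v : V}
    (hv : v ∈ homog π e a) : (der e T * mul e v : Module.End k (Fock k π)) =
      sgn k b a • (mul e v * der e T) + mul e (T v) := by
  induction hv using Submodule.span_induction with
  | mem v h =>
    obtain ⟨u, rfl, rfl⟩ := h
    rw [mul_basis, der_mul_X hT]
  | zero => simp
  | add x y _ _ hx hy => simp only [map_add, add_mul, mul_add, hx, hy, smul_add]; abel
  | smul c x _ hx =>
    simp only [map_smul, smul_mul_assoc, mul_smul_comm, hx, smul_comm c, smul_add]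

/-- An even derivation satisfies the Leibniz rule for every vector. -/
theorem der_mul_mul_of_even {T : Module.End k V} (hT : IsHomog π e 0 T) (v : V) :
    (der e T * mul e v : Module.End k (Fock k π)) = mul e v * der e T + mul e (T v) := by
  induction v using basis_induction e with
  | zero => simp
  | add x y hx hy => simp only [map_add, add_mul, mul_add, hx, hy]; abel
  | smul c t =>
    have := der_mul_X (k := k) hT t
    rw [sgn_zero_left, one_smul] at this
    simp only [map_smul, smul_mul_assoc, mul_smul_comm, mul_basis, this, smul_add]

/-- A superderivation is determined by its values on the variables: the difference of the two sides
supercommutes with every `X v` and kills the unit. -/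
theorem der_mul_der {a b : ZMod 2} {T T' : Module.End k V} (hT : IsHomog π e a T)
    (hT' : IsHomog π e b T') : (der e T * der e T' : Module.End k (Fock k π)) =
      sgn k a b • (der e T' * der e T) + der e (T * T' - sgn k a b • (T' * T)) := by
  rw [← sub_eq_zero]
  refine eq_zero_of_comm (fun v => sgn k (a + b) (π v)) (fun v => ?_) (by simp)
  have hTT : IsHomog π e (a + b) (T * T' - sgn k a b • (T' * T)) :=
    (hT.mul hT').sub ((add_comm b a ▸ hT'.mul hT).smul _)
  have h1 := der_mul_X hT v
  have h2 := der_mul_X hT' v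
  have h1' := mul_mul_of_mul_eq h1
  have h2' := mul_mul_of_mul_eq h2
  have h3 := der_mul_mul hT (hT' v)
  have h4 := der_mul_mul hT' (hT v)
  simp only [add_mul, smul_mul_assoc, mul_assoc] at h1' h2'
  simp only [sub_mul, add_mul, smul_mul_assoc, mul_assoc, h1, h2, h1', h2', mul_add, mul_sub,
    mul_smul_comm, h3, h4, der_mul_X hTT, smul_add, smul_sub, smul_smul, LinearMap.sub_apply,
    LinearMap.smul_apply, Module.End.mul_apply, map_sub, map_smul, sgn_add_left, sgn_add_right]
  rcases zmod_two_cases a with rfl | rfl <;> rcases zmod_two_cases b with rfl | rfl <;>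
    rcases zmod_two_cases (π v) with h | h <;> simp only [h, sgn_zero_left, sgn_zero_right,
      sgn_one_one] <;> module

/-- Handled separately because `der_mul_der` gives only twice this identity. The difference of the
sides is even, hence the constant sign 1. -/
theorem der_sq {T : Module.End k V} (hT : IsHomog π e 1 T) :
    (der e T * der e T : Module.End k (Fock k π)) = der e (T * T) := by
  rw [← sub_eq_zero]
  refine eq_zero_of_comm (fun v => 1) (fun v => ?_) (by simp)
  have hTT : IsHomog π e (1 + 1) (T * T) := hT.mul hT
  rw [show (1 : ZMod 2) + 1 = 0 by decide] at hTT
  have h1 := der_mul_X hT v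
  have h1' := mul_mul_of_mul_eq h1
  have h3 := der_mul_mul hT (hT v)
  simp only [add_mul, smul_mul_assoc, mul_assoc] at h1'
  simp only [sub_mul, mul_assoc, h1, h1', mul_add, mul_sub,
    mul_smul_comm, h3, der_mul_X hTT, smul_add, smul_smul, Module.End.mul_apply, sgn_add_right]
  rcases zmod_two_cases (π v) with h | h <;> simp only [h, sgn_zero_left, sgn_zero_right,
      sgn_one_one] <;> module

theorem sigma_mul_der (b : ZMod 2) {a : ZMod 2} {T : Module.End k V} (hT : IsHomog π e a T) :
    (sigma b * der e T : Module.End k (Fock k π)) = sgn k b a • (der e T * sigma b) := by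
  rw [← sub_eq_zero]
  refine eq_zero_of_comm (fun v => sgn k (a + b) (π v)) (fun v => ?_) (by simp)
  have h1 := der_mul_X hT v
  have h2 := sigma_mul_X (k := k) (π := π) b v
  have h1' := mul_mul_of_mul_eq h1
  have h2' := mul_mul_of_mul_eq h2
  have h3 := sigma_mul_mul e b (hT v)
  simp only [add_mul, smul_mul_assoc, mul_assoc] at h1' h2'
  simp only [sub_mul, smul_mul_assoc, mul_assoc, h1, h2, h1', h2', mul_add, mul_sub,
    mul_smul_comm, h3, smul_add, smul_sub, smul_smul, sgn_add_left, sgn_add_right]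
  module

theorem der_mem_deg {a : ZMod 2} {T : Module.End k V} (hT : IsHomog π e a T) {d : ℕ}
    {s : Fock k π} (hs : s ∈ deg k π d) : der e T s ∈ deg k π d := by
  induction hs using Submodule.span_induction with
  | mem s h =>
    obtain ⟨l, hl, rfl⟩ := h
    refine deg_mono hl ?_
    clear hl
    induction l with
    | nil => simp
    | cons t l ih =>
      have := LinearMap.congr_fun (der_mul_X (k := k) hT t) (word l vac)
      rw [word_cons, Module.End.mul_apply, ← Module.End.mul_apply, this]
      exact add_mem (Submodule.smul_mem _ _ (X_mem_deg t ih)) (mul_mem_deg e _ (word_mem_deg le_rfl))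
  | zero => simp
  | add x y _ _ hx hy => rw [map_add]; exact add_mem hx hy
  | smul c x _ hx => rw [map_smul]; exact Submodule.smul_mem _ c hx

/-- When `w` does not occur in `f`, its derivative sees only the coefficient of `w` in the new
factor `v`. -/
theorem D_mul_mul (w : I) (v : V) {f : Fock k π} (hf : D w f = 0) :
    D w (mul e v f) = e.repr v w • f := by
  induction v using basis_induction e with
  | zero => simp
  | add x y hx hy => simp [hx, hy, add_smul]
  | smul c t =>
    have := LinearMap.congr_fun (D_mul_X (k := k) w t) f
    simp only [Module.End.mul_apply, LinearMap.add_apply, LinearMap.smul_apply, hf, map_zero,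
      smul_zero, zero_add] at this
    by_cases h : w = t
    · subst h; simp [this]
    · simp [this, h]

/-- Extracts from a derivation the part linear in a variable `w` foreign to `f`; this is how
invariance becomes linear relations among the derivatives of `f`. -/
theorem D_der (T : Module.End k V) (w : I) {f : Fock k π} (hf : D w f = 0) {G : Finset I}
    (h : ∀ t ∉ G, D t f = 0) :
    D w (der e T f) = ∑ t ∈ G, e.repr (T (e t)) w • D t f := by
  rw [der_apply e T h, map_sum]
  refine Finset.sum_congr rfl fun t _ => D_mul_mul w _ ?_
  have := LinearMap.congr_fun (D_mul_D (k := k) w t) f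
  simpa [hf] using this

end Fock

end SuperCurrent

/-! ### Left and right actions of the current superalgebra on the supersymmetric algebra. -/

namespace SuperCurrent

open Fock

/-- The indices of the basis elements `e_{i,j} x^r`. -/
abbrev Idx (m n : ℕ) : Type := Fin (m + n) × Fin (m + n) × ℕ

/-- The parity of `e_{i,j} x^r`. -/
def par (m n : ℕ) (t : Idx m n) : ZMod 2 := parity m n t.1 + parity m n t.2.1

section Basis

variable (k : Type*) [Field k] (m n : ℕ)

/-- The basis of the `e_{i,j} x^r`. -/
def basis : Module.Basis (Idx m n) k (Cur k m n) :=
  ((Matrix.stdBasis k (Fin (m + n)) (Fin (m + n))).tensorProduct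
    (Polynomial.basisMonomials k)).reindex (Equiv.prodAssoc _ _ _)

@[simp] theorem basis_apply (t : Idx m n) : basis k m n t = e k m n t.1 t.2.1 t.2.2 := by
  simp [basis, e, Module.Basis.tensorProduct_apply, Matrix.stdBasis_eq_single,
    Polynomial.X_pow_eq_monomial]

theorem part_eq_homog (a : ZMod 2) : part k m n a = homog (par m n) (basis k m n) a := by
  unfold part homog
  congr 1
  ext x
  constructor
  · rintro ⟨i, j, r, h, rfl⟩
    exact ⟨(i, j, r), h, by simp⟩
  · rintro ⟨t, h, rfl⟩
    exact ⟨t.1, t.2.1, t.2.2, h, by simp⟩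

end Basis

variable {k : Type*} [Field k] {m n : ℕ}

theorem e_mem_part (i j : Fin (m + n)) (r : ℕ) :
    e k m n i j r ∈ part k m n (parity m n i + parity m n j) :=
  Submodule.subset_span ⟨i, j, r, rfl, rfl⟩

theorem zmod_two_add_self (a : ZMod 2) : a + a = 0 := by
  revert a; decide

theorem mul_mem_part {a b : ZMod 2} {x y : Cur k m n} (hx : x ∈ part k m n a)
    (hy : y ∈ part k m n b) : x * y ∈ part k m n (a + b) := by
  induction hx using Submodule.span_induction with
  | mem x h =>
    obtain ⟨i, j, r, rfl, rfl⟩ := h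
    induction hy using Submodule.span_induction with
    | mem y h =>
      obtain ⟨i', j', r', rfl, rfl⟩ := h
      rw [e_mul_e]
      split_ifs with h
      · subst h
        have : parity m n i + parity m n j + (parity m n j + parity m n j') =
            parity m n i + parity m n j' := by
          rw [add_assoc, ← add_assoc (parity m n j), zmod_two_add_self, zero_add]
        rw [this]
        exact e_mem_part _ _ _
      · exact zero_mem _
    | zero => simp
    | add x y _ _ hx hy => rw [mul_add]; exact add_mem hx hy
    | smul c x _ hx => rw [mul_smul_comm]; exact Submodule.smul_mem _ c hx
  | zero => simp
  | add x y _ _ hx hy => rw [add_mul]; exact add_mem hx hy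
  | smul c x _ hx => rw [smul_mul_assoc]; exact Submodule.smul_mem _ c hx

theorem isHomog_mulLeft {b : ZMod 2} {x : Cur k m n} (hx : x ∈ part k m n b) :
    IsHomog (par m n) (basis k m n) b (LinearMap.mulLeft k x) := fun t => by
  rw [← part_eq_homog]
  exact mul_mem_part hx (by rw [part_eq_homog]; exact basis_mem_homog _ t)

/-- The right multiplication by an element `x` of parity `b`, `y ↦ (-1)^{b|y|} y x`. -/
def rmul (b : ZMod 2) (x : Cur k m n) : Module.End k (Cur k m n) :=
  (basis k m n).constr k fun t => sgn k b (par m n t) • (basis k m n t * x)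

theorem rmul_basis (b : ZMod 2) (x : Cur k m n) (t : Idx m n) :
    rmul b x (basis k m n t) = sgn k b (par m n t) • (basis k m n t * x) :=
  (basis k m n).constr_basis k _ t

theorem rmul_apply (b : ZMod 2) (x : Cur k m n) {a : ZMod 2} {y : Cur k m n}
    (hy : y ∈ part k m n a) : rmul b x y = sgn k b a • (y * x) := by
  rw [part_eq_homog] at hy
  induction hy using Submodule.span_induction with
  | mem v h =>
    obtain ⟨u, rfl, rfl⟩ := h
    exact rmul_basis b x u
  | zero => simp
  | add x y _ _ hx hy => simp only [map_add, hx, hy, add_mul, smul_add]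
  | smul c x _ hx => simp only [map_smul, hx, smul_mul_assoc, smul_comm c]

theorem isHomog_rmul {b : ZMod 2} {x : Cur k m n} (hx : x ∈ part k m n b) :
    IsHomog (par m n) (basis k m n) b (rmul b x) := fun t => by
  rw [← part_eq_homog, rmul_basis, add_comm b]
  exact Submodule.smul_mem _ _
    (mul_mem_part (by rw [part_eq_homog]; exact basis_mem_homog _ t) hx)

variable (k m n) in
/-- The action of `gl_{m|n}[x]` on the supersymmetric algebra: the sum of the multiplication by `x`
and of the superderivation that extends the left multiplication by `x`. -/
def act : Cur k m n →ₗ[k] Module.End k (Fock k (par m n)) where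
  toFun x := mul (basis k m n) x + der (basis k m n) (LinearMap.mulLeft k x)
  map_add' x y := by
    have : LinearMap.mulLeft k (x + y) = LinearMap.mulLeft k x + LinearMap.mulLeft k y := by
      exact LinearMap.ext fun v => by simp [add_mul]
    rw [map_add, this, der_add]
    abel
  map_smul' c x := by
    have : LinearMap.mulLeft k (c • x) = c • LinearMap.mulLeft k x := by
      exact LinearMap.ext fun v => smul_mul_assoc c x v
    rw [map_smul, this, der_smul, smul_add, RingHom.id_apply]

theorem act_apply (x : Cur k m n) :
    act k m n x = mul (basis k m n) x + der (basis k m n) (LinearMap.mulLeft k x) := rfl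

/-- Associativity makes `x ↦ der (mulLeft x)` respect brackets; multiplications supercommute; and
the mixed terms contribute, by the Leibniz rule, multiplication by `x y` and `y x` with the right
signs, that is, by the bracket. -/
theorem act_comm {a b : ZMod 2} {x y : Cur k m n} (hx : x ∈ part k m n a)
    (hy : y ∈ part k m n b) : act k m n x * act k m n y - sgn k a b • (act k m n y * act k m n x) =
      act k m n (bracket x y) := by
  have hT : LinearMap.mulLeft k (x * y - sgn k a b • (y * x)) =
      LinearMap.mulLeft k x * LinearMap.mulLeft k y -
        sgn k a b • (LinearMap.mulLeft k y * LinearMap.mulLeft k x) := by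
    refine LinearMap.ext fun v => ?_
    rw [LinearMap.mulLeft_apply, sub_mul, smul_mul_assoc, mul_assoc, mul_assoc]
    rfl
  have hx' := hx
  have hy' := hy
  rw [part_eq_homog] at hx' hy'
  rw [bracket_of_mem hx hy, act_apply (x * y - _), hT]
  simp only [act_apply, add_mul, mul_add, smul_add, map_sub, map_smul,
    mul_mul_mul _ hx' hy', der_mul_mul (isHomog_mulLeft hx) hy',
    der_mul_mul (isHomog_mulLeft hy) hx', der_mul_der (isHomog_mulLeft hx) (isHomog_mulLeft hy),
    LinearMap.mulLeft_apply, smul_smul, sgn_symm k b a, sgn_mul_self, one_smul]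
  module

/-- The square of the multiplication vanishes, the mixed terms leave multiplication by `y * y`, and
the derivation squares to that of `y * y`. This is the relation that characteristic 2 requires
beyond `act_comm`. -/
theorem act_sq {y : Cur k m n} (hy : y ∈ part k m n 1) :
    act k m n y * act k m n y = act k m n (y * y) := by
  have hT : LinearMap.mulLeft k (y * y) = LinearMap.mulLeft k y * LinearMap.mulLeft k y := by
    exact LinearMap.ext fun v => mul_assoc y y v
  have hy' := hy
  rw [part_eq_homog] at hy'
  simp only [act_apply, add_mul, mul_add, mul_sq _ hy', der_mul_mul (isHomog_mulLeft hy) hy',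
    der_sq (isHomog_mulLeft hy), hT, sgn_one_one, LinearMap.mulLeft_apply]
  module

variable (k m n) in
/-- The action of the enveloping superalgebra on the supersymmetric algebra. -/
def rep : U k m n →ₐ[k] Module.End k (Fock k (par m n)) :=
  RingQuot.liftAlgHom k ⟨TensorAlgebra.lift k (act k m n), by
    intro x y h
    induction h with
    | comm a b x y hx hy => simpa using act_comm hx hy
    | square y hy => simpa using act_sq hy⟩

@[simp] theorem rep_ι (x : Cur k m n) : rep k m n (ι k m n x) = act k m n x := by
  simp [rep, ι]

/-- The product of the `e_{i,j} x^r` over a list of indices. -/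
def uword (l : List (Idx m n)) : U k m n := (l.map fun t => ι k m n (e k m n t.1 t.2.1 t.2.2)).prod

@[simp] theorem uword_nil : (uword [] : U k m n) = 1 := rfl

@[simp] theorem uword_cons (t : Idx m n) (l : List (Idx m n)) :
    (uword (t :: l) : U k m n) = ι k m n (basis k m n t) * uword l := by simp [uword]

theorem span_uword_eq_top : Submodule.span k (Set.range (uword (k := k) (m := m) (n := n))) = ⊤ := by
  set S := Submodule.span k (Set.range (uword (k := k) (m := m) (n := n)))
  have hι : ∀ x : Cur k m n, ∀ s ∈ S, ι k m n x * s ∈ S := by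
    intro x s hs
    induction x using basis_induction (basis k m n) with
    | zero => simp
    | add x y hx hy => simpa [add_mul] using add_mem hx hy
    | smul c t =>
      rw [map_smul, smul_mul_assoc]
      refine Submodule.smul_mem _ c ?_
      induction hs using Submodule.span_induction with
      | mem s h =>
        obtain ⟨l, rfl⟩ := h
        exact Submodule.subset_span ⟨t :: l, uword_cons t l⟩
      | zero => simp
      | add x y _ _ hx hy => rw [mul_add]; exact add_mem hx hy
      | smul c x _ hx => rw [mul_smul_comm]; exact Submodule.smul_mem _ c hx
  have key : ∀ a : TensorAlgebra k (Cur k m n), ∀ s ∈ S,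
      RingQuot.mkAlgHom k (Rel k m n) a * s ∈ S := by
    intro a
    induction a using TensorAlgebra.induction with
    | algebraMap r =>
      intro s hs
      rw [AlgHom.commutes, ← Algebra.smul_def]
      exact Submodule.smul_mem _ r hs
    | ι x => exact hι x
    | mul a b ha hb =>
      intro s hs
      rw [map_mul, mul_assoc]
      exact ha _ (hb s hs)
    | add a b ha hb =>
      intro s hs
      rw [map_add, add_mul]
      exact add_mem (ha s hs) (hb s hs)
  refine eq_top_iff.2 fun u _ => ?_
  obtain ⟨a, rfl⟩ := RingQuot.mkAlgHom_surjective k (Rel k m n) u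
  simpa using key a 1 (Submodule.subset_span ⟨[], rfl⟩)

/-- The right action of an element `x` of parity `b` on the supersymmetric algebra. -/
def ract (b : ZMod 2) (x : Cur k m n) : Module.End k (Fock k (par m n)) :=
  mul (basis k m n) x + der (basis k m n) (rmul b x)

/-- The right action commutes with the left action. -/
theorem act_mul_right {a b : ZMod 2} {x y : Cur k m n} (hy : y ∈ part k m n a)
    (hx : x ∈ part k m n b) :
    act k m n y * ract b x = sgn k a b • (ract b x * act k m n y) := by
  -- Left and right multiplications supercommute by associativity, so the derivation parts do as
  -- well; the mixed terms are both multiplications by `y x` and match up to sign.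
  have hT : LinearMap.mulLeft k y * rmul b x -
        sgn k a b • (rmul b x * LinearMap.mulLeft k y) = 0 := by
    refine (basis k m n).ext fun t => ?_
    have ht : basis k m n t ∈ part k m n (par m n t) := by
      rw [part_eq_homog]; exact basis_mem_homog _ t
    simp only [LinearMap.sub_apply, LinearMap.smul_apply, Module.End.mul_apply,
      LinearMap.mulLeft_apply, rmul_apply b x ht, rmul_apply b x (mul_mem_part hy ht),
      smul_smul, sgn_add_right, mul_smul_comm, LinearMap.zero_apply]
    rw [← mul_assoc, sgn_symm k b a, ← mul_assoc (sgn k a b), sgn_mul_self, one_mul, mul_assoc, sub_self]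
  have h0 : der (basis k m n) (0 : Module.End k (Cur k m n)) =
      (0 : Module.End k (Fock k (par m n))) := by
    simpa using der_smul (π := par m n) (basis k m n) (0 : k) 0
  have hx' := hx
  have hy' := hy
  rw [part_eq_homog] at hx' hy'
  simp only [ract, act_apply, add_mul, mul_add, smul_add,
    mul_mul_mul _ hy' hx', der_mul_mul (isHomog_mulLeft hy) hx',
    der_mul_mul (isHomog_rmul hx) hy', der_mul_der (isHomog_mulLeft hy) (isHomog_rmul hx), hT, h0,
    LinearMap.mulLeft_apply, rmul_apply b x hy, map_smul, smul_smul, sgn_symm k b a, sgn_mul_self,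
    one_smul]
  module

theorem sigma_mul_act (b : ZMod 2) {a : ZMod 2} {x : Cur k m n} (hx : x ∈ part k m n a) :
    sigma b * act k m n x = sgn k b a • (act k m n x * sigma b) := by
  have hx' := hx
  rw [part_eq_homog] at hx'
  simp only [act_apply, mul_add, add_mul, smul_add, sigma_mul_mul _ b hx',
    sigma_mul_der b (isHomog_mulLeft hx)]

/-- Right multiplication by a homogeneous current, on symbols. -/
theorem rep_mul_ι {b : ZMod 2} {x : Cur k m n} (hx : x ∈ part k m n b) (u : U k m n) :
    rep k m n (u * ι k m n x) vac = ract b x (sigma b (rep k m n u vac)) := by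
  have hu : u ∈ Submodule.span k (Set.range (uword (k := k) (m := m) (n := n))) := by
    rw [span_uword_eq_top]; trivial
  induction hu using Submodule.span_induction with
  | mem u h =>
    obtain ⟨l, rfl⟩ := h
    induction l with
    | nil => simp [act_apply, ract]
    | cons t l ih =>
      have ht : basis k m n t ∈ part k m n (par m n t) := by
        rw [part_eq_homog]; exact basis_mem_homog _ t
      -- The right action moves past each left factor; the sign this costs is the one that `sigma b`
      -- yields on the same factor. For the empty word both actions of `x` give `x`.
      have h1 := LinearMap.congr_fun (act_mul_right ht hx) (sigma b (rep k m n (uword l) vac))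
      have h2 := LinearMap.congr_fun (sigma_mul_act b ht) (rep k m n (uword l) vac)
      simp only [Module.End.mul_apply, LinearMap.smul_apply] at h1 h2
      rw [uword_cons, mul_assoc, map_mul, Module.End.mul_apply, ih, rep_ι, h1, map_mul,
        Module.End.mul_apply, rep_ι, h2, map_smul, sgn_symm]
  | zero => simp
  | add x y _ _ hx hy => simp only [add_mul, map_add, LinearMap.add_apply] at hx hy ⊢; rw [hx, hy]
  | smul c x _ hx =>
    rw [smul_mul_assoc, map_smul, LinearMap.smul_apply, hx, map_smul, LinearMap.smul_apply,
      map_smul, map_smul]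

/-- Symbols keep the parity, so the sign operator in `rep_mul_ι` becomes a scalar on homogeneous
elements. -/
theorem sigma_rep_of_mem_UPart (b : ZMod 2) {a : ZMod 2} {u : U k m n} (hu : u ∈ UPart k m n a) :
    sigma b (rep k m n u vac) = sgn k b a • rep k m n u vac := by
  induction hu using Submodule.span_induction with
  | mem u h =>
    obtain ⟨l, rfl, rfl⟩ := h
    change sigma b (rep k m n (uword l) vac) = _ • rep k m n (uword l) vac
    induction l with
    | nil => simp
    | cons t l ih =>
      have ht : basis k m n t ∈ part k m n (par m n t) := by
        rw [part_eq_homog]; exact basis_mem_homog _ t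
      have h2 := LinearMap.congr_fun (sigma_mul_act b ht) (rep k m n (uword l) vac)
      simp only [Module.End.mul_apply, LinearMap.smul_apply] at h2
      rw [uword_cons, map_mul, Module.End.mul_apply, rep_ι, h2, ih, map_smul, smul_smul,
        List.map_cons, List.sum_cons, sgn_add_right]
      rfl
  | zero => simp
  | add x y _ _ hx hy => rw [map_add, LinearMap.add_apply, map_add, hx, hy, smul_add]
  | smul c x _ hx => rw [map_smul, LinearMap.smul_apply, map_smul, hx, smul_comm]

/-- The symbol of a central element is invariant. -/
theorem der_eq_of_mem_centerPart {a b : ZMod 2} {u : U k m n} (hu : u ∈ centerPart k m n a)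
    {x : Cur k m n} (hx : x ∈ part k m n b) :
    der (basis k m n) (LinearMap.mulLeft k x) (rep k m n u vac) =
      der (basis k m n) (rmul b x) (rep k m n u vac) := by
  -- Apply both sides of the centrality relation to the unit: the signs agree and the
  -- multiplications by `x` cancel, leaving the two superderivations.
  have h := congrArg (fun v => rep k m n v vac) (hu.2 b x hx)
  rw [rep_mul_ι hx] at h
  simp only [sigma_rep_of_mem_UPart b hu.1, map_smul, map_mul, rep_ι,
    LinearMap.smul_apply, Module.End.mul_apply, act_apply, ract, LinearMap.add_apply,
    sgn_symm k b a] at h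
  exact (add_left_cancel (smul_right_injective _ (sgn_ne_zero k a b) h)).symm

end SuperCurrent

/-! ### The Poincaré–Birkhoff–Witt theorem. -/

namespace SuperCurrent

/-- Two linear maps that agree up to terms of lower degree have the same range, and one is injective
if the other is. -/
theorem injective_and_range_eq_of_triangular {k W S : Type*} [Field k] [AddCommGroup W] [Module k W]
    [AddCommGroup S] [Module k S] {A B : W →ₗ[k] S} (F : ℕ → Submodule k W)
    (hF : ∀ w, ∃ d, w ∈ F d) (hB : Function.Injective B) (h0 : ∀ w ∈ F 0, A w = B w)
    (hs : ∀ d, ∀ w ∈ F (d + 1), ∃ w' ∈ F d, A w = B w + B w') :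
    Function.Injective A ∧ LinearMap.range A = LinearMap.range B := by
  refine ⟨(injective_iff_map_eq_zero A).2 fun w hw => ?_, le_antisymm ?_ ?_⟩
  · obtain ⟨d, hd⟩ := hF w
    induction d with
    | zero => exact hB (by rw [← h0 w hd, hw, map_zero])
    | succ d ih =>
      obtain ⟨w', hw', h⟩ := hs d w hd
      rw [hw, ← map_add] at h
      have : w + w' = 0 := hB (by rw [← h, map_zero])
      exact ih (eq_neg_of_add_eq_zero_left this ▸ neg_mem hw')
  · rintro _ ⟨w, rfl⟩
    obtain ⟨d, hd⟩ := hF w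
    cases d with
    | zero => exact ⟨w, (h0 w hd).symm⟩
    | succ d =>
      obtain ⟨w', -, h⟩ := hs d w hd
      exact ⟨w + w', by rw [h, map_add]⟩
  · rintro _ ⟨w, rfl⟩
    obtain ⟨d, hd⟩ := hF w
    induction d generalizing w with
    | zero => exact ⟨w, h0 w hd⟩
    | succ d ih =>
      obtain ⟨w', hw', h⟩ := hs d w hd
      rw [eq_sub_of_add_eq h.symm]
      exact sub_mem ⟨w, rfl⟩ (ih w' hw')

namespace Fock

variable {k : Type*} [Field k] {I : Type*} [DecidableEq I] [Encodable I] {π : I → ZMod 2}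

theorem vars_add_single (F : Finset {t // π t ≠ 0}) (a : {t // π t = 0} →₀ ℕ) (t : {t // π t = 0}) :
    vars (F, a + Finsupp.single t 1) = t.1 ::ₘ vars (F, a) := by
  rw [vars, vars, map_add, Finsupp.toMultiset_single, one_smul, Multiset.map_add,
    Multiset.map_singleton, ← add_assoc, Multiset.add_comm, Multiset.singleton_add]

theorem vars_insert {F : Finset {t // π t ≠ 0}} (a : {t // π t = 0} →₀ ℕ) {t : {t // π t ≠ 0}}
    (ht : t ∉ F) : vars (insert t F, a) = t.1 ::ₘ vars (F, a) := by
  simp [vars, Finset.insert_val_of_notMem ht]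

theorem X_mono (t : I) (b : Finset {t // π t ≠ 0} × ({t // π t = 0} →₀ ℕ)) :
    X t (mono b : Fock k π) = 0 ∨ ∃ (c : k) (b' : _), vars b' = t ::ₘ vars b ∧
      X t (mono b : Fock k π) = c • mono b' := by
  obtain ⟨F, a⟩ := b
  by_cases h : π t = 0
  · right
    refine ⟨1, (F, a + Finsupp.single ⟨t, h⟩ 1), ?_, ?_⟩
    · exact vars_add_single F a ⟨t, h⟩
    · rw [X, dif_pos h, mono, mono, evX_single, mul_comm, MvPolynomial.X,
        MvPolynomial.monomial_mul, one_mul, one_smul]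
  · by_cases hF : ⟨t, h⟩ ∈ F
    · left
      simp [X, h, mono, oddX_single, hF]
    · right
      refine ⟨(-1) ^ below ⟨t, h⟩ F, (insert ⟨t, h⟩ F, a), ?_, ?_⟩
      · exact vars_insert a hF
      · rw [X, dif_neg h, mono, mono, oddX_single, if_neg hF]

theorem word_eq_smul_mono (l : List I) : (word l vac : Fock k π) = 0 ∨
    ∃ (c : k) (b : _), vars b = (l : Multiset I) ∧ word l vac = c • (mono b : Fock k π) := by
  induction l with
  | nil => exact Or.inr ⟨1, (∅, 0), by simp [vars], by simp [mono, vac]⟩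
  | cons t l ih =>
    rcases ih with h | ⟨c, b, hb, h⟩
    · left; simp [h]
    · rcases X_mono (k := k) t b with h' | ⟨c', b', hb', h'⟩
      · left; simp [h, h']
      · exact Or.inr ⟨c * c', b', by rw [hb', hb, Multiset.cons_coe], by simp [h, h', smul_smul]⟩

/-- The dichotomy behind the straightening of words: sort into an ordered monomial, or shorten by
squaring a repeated odd letter. -/
theorem exists_vars_eq_or (l : List I) :
    (∃ b : Finset {t // π t ≠ 0} × ({t // π t = 0} →₀ ℕ), vars b = (l : Multiset I)) ∨
      ∃ t l', π t = 1 ∧ l.Perm (t :: t :: l') := by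
  induction l with
  | nil => exact Or.inl ⟨(∅, 0), by simp [vars]⟩
  | cons t l ih =>
    rcases ih with ⟨⟨F, a⟩, hb⟩ | ⟨u, l', hu, h⟩
    · by_cases h : π t = 0
      · exact Or.inl ⟨(F, a + Finsupp.single ⟨t, h⟩ 1),
          by rw [vars_add_single F a ⟨t, h⟩, hb, Multiset.cons_coe]⟩
      · by_cases hF : ⟨t, h⟩ ∈ F
        · have : t ∈ l := by
            rw [← Multiset.mem_coe, ← hb, vars, Multiset.mem_add]
            exact Or.inl (Multiset.mem_map.2 ⟨⟨t, h⟩, hF, rfl⟩)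
          exact Or.inr ⟨t, l.erase t, eq_one_of_ne_zero h, (List.perm_cons_erase this).cons t⟩
        · exact Or.inl ⟨(insert ⟨t, h⟩ F, a), by rw [vars_insert a hF, hb, Multiset.cons_coe]⟩
    · exact Or.inr ⟨u, t :: l', hu, (h.cons t).trans
        ((List.Perm.swap u t _).trans ((List.Perm.swap u t _).cons u))⟩

theorem coeff_linearCombination_mono
    (w : (Finset {t // π t ≠ 0} × ({t // π t = 0} →₀ ℕ)) →₀ k) (F) (a) :
    MvPolynomial.coeff a (coeff F (Finsupp.linearCombination k (mono (k := k) (π := π)) w)) =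
      w (F, a) := by
  induction w using Finsupp.induction_linear with
  | zero => simp
  | add f g hf hg => simp [hf, hg]
  | single b c =>
    obtain ⟨G, a'⟩ := b
    by_cases h : G = F <;> by_cases h' : a' = a <;>
      simp [mono, coeff_single, h, h', MvPolynomial.coeff_monomial]

theorem linearCombination_mono_injective :
    Function.Injective (Finsupp.linearCombination k (mono (k := k) (π := π))) := fun v w h => by
  ext ⟨F, a⟩
  rw [← coeff_linearCombination_mono v, h, coeff_linearCombination_mono]

end Fock

open Fock

variable {k : Type*} [Field k] {m n : ℕ}

theorem basis_mem_part (t : Idx m n) : basis k m n t ∈ part k m n (par m n t) := by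
  rw [part_eq_homog]; exact basis_mem_homog _ t

variable (k m n) in
/-- The span of the products of at most `d` elements of `gl_{m|n}[x]`. -/
def udeg (d : ℕ) : Submodule k (U k m n) :=
  Submodule.span k {u | ∃ l : List (Idx m n), l.length ≤ d ∧ u = uword l}

theorem uword_mem_udeg {l : List (Idx m n)} {d : ℕ} (h : l.length ≤ d) :
    (uword l : U k m n) ∈ udeg k m n d :=
  Submodule.subset_span ⟨l, h, rfl⟩

theorem ι_mul_mem_udeg (x : Cur k m n) {d : ℕ} {u : U k m n} (hu : u ∈ udeg k m n d) :
    ι k m n x * u ∈ udeg k m n (d + 1) := by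
  induction x using basis_induction (basis k m n) with
  | zero => simp
  | add x y hx hy => simpa [add_mul] using add_mem hx hy
  | smul c t =>
    rw [map_smul, smul_mul_assoc]
    refine Submodule.smul_mem _ c ?_
    induction hu using Submodule.span_induction with
    | mem u h =>
      obtain ⟨l, hl, rfl⟩ := h
      exact Submodule.subset_span ⟨t :: l, by simpa using hl, (uword_cons t l).symm⟩
    | zero => simp
    | add x y _ _ hx hy => rw [mul_add]; exact add_mem hx hy
    | smul c x _ hx => rw [mul_smul_comm]; exact Submodule.smul_mem _ c hx

theorem udeg_mono {d d' : ℕ} (h : d ≤ d') : udeg k m n d ≤ udeg k m n d' :=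
  Submodule.span_mono fun _ ⟨l, hl, hs⟩ => ⟨l, hl.trans h, hs⟩

theorem ι_comm {a b : ZMod 2} {x y : Cur k m n} (hx : x ∈ part k m n a) (hy : y ∈ part k m n b) :
    ι k m n x * ι k m n y - sgn k a b • (ι k m n y * ι k m n x) = ι k m n (bracket x y) := by
  have := RingQuot.mkAlgHom_rel k (Rel.comm a b x y hx hy)
  simpa [ι] using this

theorem ι_sq {y : Cur k m n} (hy : y ∈ part k m n 1) :
    ι k m n y * ι k m n y = ι k m n (y * y) := by
  have := RingQuot.mkAlgHom_rel k (Rel.square y hy)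
  simpa [ι] using this

/-- Each adjacent swap costs a sign and a bracket term, which is one letter shorter. -/
theorem uword_perm {l l' : List (Idx m n)} (h : l.Perm l') : ∀ d, l.length ≤ d + 1 →
    ∃ c : k, uword l - c • (uword l' : U k m n) ∈ udeg k m n d := by
  induction h with
  | nil => exact fun d _ => ⟨1, by simp⟩
  | @cons t l l' hl ih =>
    intro d hd
    cases d with
    | zero =>
      have : l = [] := by simpa using hd
      subst this
      rw [List.nil_perm.1 hl]
      exact ⟨1, by simp⟩
    | succ d =>
      obtain ⟨c, hc⟩ := ih d (by simpa using hd)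
      refine ⟨c, ?_⟩
      rw [uword_cons, uword_cons, ← mul_smul_comm, ← mul_sub]
      exact ι_mul_mem_udeg _ hc
  | swap u t l =>
    intro d hd
    refine ⟨sgn k (par m n t) (par m n u), ?_⟩
    have h1 := ι_comm (k := k) (m := m) (n := n) (basis_mem_part t) (basis_mem_part u)
    have : uword (t :: u :: l) - sgn k (par m n t) (par m n u) • uword (u :: t :: l) =
        ι k m n (bracket (basis k m n t) (basis k m n u)) * uword l := by
      rw [← h1]
      simp only [uword_cons, sub_mul, smul_mul_assoc, mul_assoc]
    rw [this]
    have hl : l.length + 1 ≤ d := by simpa using hd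
    exact udeg_mono hl (ι_mul_mem_udeg _ (uword_mem_udeg le_rfl))
  | @trans l₁ l₂ l₃ h1 _ ih1 ih2 =>
    intro d hd
    obtain ⟨c, hc⟩ := ih1 d hd
    obtain ⟨c', hc'⟩ := ih2 d (h1.length_eq ▸ hd)
    refine ⟨c * c', ?_⟩
    have := add_mem hc (Submodule.smul_mem _ c hc')
    convert this using 1
    module

variable (k) in
/-- A word that represents a given monomial. -/
def monoWord (b : Finset {t // par m n t ≠ 0} × ({t // par m n t = 0} →₀ ℕ)) : List (Idx m n) :=
  (exists_word_eq_mono (k := k) b).choose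

theorem coe_monoWord (b : Finset {t // par m n t ≠ 0} × ({t // par m n t = 0} →₀ ℕ)) :
    (monoWord k b : Multiset (Idx m n)) = vars b :=
  (exists_word_eq_mono (k := k) b).choose_spec.1

theorem word_monoWord (b : Finset {t // par m n t ≠ 0} × ({t // par m n t = 0} →₀ ℕ)) :
    word (monoWord k b) vac = (mono b : Fock k (par m n)) :=
  (exists_word_eq_mono (k := k) b).choose_spec.2

theorem length_monoWord {b : Finset {t // par m n t ≠ 0} × ({t // par m n t = 0} →₀ ℕ)}
    {l : List (Idx m n)} (h : vars b = (l : Multiset (Idx m n))) :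
    (monoWord k b).length = l.length := by
  rw [← Multiset.coe_card, ← Multiset.coe_card, coe_monoWord, h]

variable (k m n) in
/-- The linear combinations of ordered monomials in the enveloping superalgebra. -/
def orderedComb :
    ((Finset {t // par m n t ≠ 0} × ({t // par m n t = 0} →₀ ℕ)) →₀ k) →ₗ[k] U k m n :=
  Finsupp.linearCombination k fun b => uword (monoWord k b)

theorem uword_mem_range_orderedComb (d : ℕ) : ∀ l : List (Idx m n), l.length ≤ d →
    (uword l : U k m n) ∈ LinearMap.range (orderedComb k m n) := by
  have hmono : ∀ b, (uword (monoWord k b) : U k m n) ∈ LinearMap.range (orderedComb k m n) :=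
    fun b => ⟨Finsupp.single b 1, by simp [orderedComb]⟩
  induction d with
  | zero =>
    intro l hl
    have : l = [] := by simpa using hl
    subst this
    have h0 : monoWord k (m := m) (n := n) (∅, 0) = [] := by
      rw [← Multiset.coe_eq_zero, coe_monoWord]; simp [vars]
    exact h0 ▸ hmono (∅, 0)
  | succ d ih =>
    intro l hl
    have hdeg : udeg k m n d ≤ LinearMap.range (orderedComb k m n) := by
      rw [udeg, Submodule.span_le]
      rintro _ ⟨l, hl, rfl⟩
      exact ih l hl
    rcases exists_vars_eq_or (π := par m n) l with ⟨b, hb⟩ | ⟨t, l', ht, h⟩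
    · have hp : l.Perm (monoWord k b) := by
        rw [← Multiset.coe_eq_coe, coe_monoWord, hb]
      obtain ⟨c, hc⟩ := uword_perm (k := k) hp d hl
      simpa using add_mem (hdeg hc) (Submodule.smul_mem _ c (hmono b))
    · obtain ⟨c, hc⟩ := uword_perm (k := k) h d hl
      -- The square of the repeated odd letter is a single element of `g`, so the word drops in
      -- degree.
      have h2 : (uword (t :: t :: l') : U k m n) ∈ udeg k m n d := by
        have hsq := ι_sq (k := k) (ht ▸ basis_mem_part t)
        rw [uword_cons, uword_cons, ← mul_assoc, hsq]
        refine udeg_mono ?_ (ι_mul_mem_udeg _ (uword_mem_udeg (l := l') le_rfl))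
        have := h.length_eq
        simp only [List.length_cons] at this
        omega
      simpa using add_mem (hdeg hc) (Submodule.smul_mem _ c (hdeg h2))

theorem orderedComb_surjective : Function.Surjective (orderedComb k m n) := by
  rw [← LinearMap.range_eq_top, eq_top_iff, ← span_uword_eq_top, Submodule.span_le]
  rintro _ ⟨l, rfl⟩
  exact uword_mem_range_orderedComb _ l le_rfl

theorem act_mem_deg (t : Idx m n) {d : ℕ} {s : Fock k (par m n)} (hs : s ∈ deg k (par m n) d) :
    act k m n (basis k m n t) s ∈ deg k (par m n) (d + 1) :=
  add_mem (mul_mem_deg _ _ hs)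
    (deg_mono (Nat.le_succ d) (der_mem_deg (isHomog_mulLeft (basis_mem_part t)) hs))

theorem rep_uword_mem_deg (l : List (Idx m n)) :
    rep k m n (uword l) vac ∈ deg k (par m n) l.length := by
  induction l with
  | nil =>
    rw [uword_nil, map_one]
    exact word_mem_deg (l := []) le_rfl
  | cons t l ih =>
    rw [uword_cons, map_mul, Module.End.mul_apply, rep_ι]
    exact act_mem_deg t ih

/-- The derivation part of the action does not raise the degree, so the multiplication part alone
gives the leading term. -/
theorem rep_uword_sub_mem_deg (l : List (Idx m n)) : ∀ d, l.length ≤ d + 1 →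
    rep k m n (uword l) vac - word l vac ∈ deg k (par m n) d := by
  induction l with
  | nil => simp
  | cons t l ih =>
    intro d hd
    have hl : l.length ≤ d := by simpa using hd
    have h1 : rep k m n (uword (t :: l)) vac - word (t :: l) vac =
        X t (rep k m n (uword l) vac - word l vac) +
          der (basis k m n) (LinearMap.mulLeft k (basis k m n t)) (rep k m n (uword l) vac) := by
      rw [uword_cons, map_mul, Module.End.mul_apply, rep_ι, act_apply, LinearMap.add_apply,
        mul_basis, word_cons, Module.End.mul_apply, map_sub]
      abel
    rw [h1]
    refine add_mem ?_ (der_mem_deg (isHomog_mulLeft (basis_mem_part t))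
      (deg_mono hl (rep_uword_mem_deg l)))
    cases d with
    | zero =>
      have : l = [] := by simpa using hl
      subst this
      simp
    | succ d => exact X_mem_deg t (ih d hl)

variable (k m n) in
/-- The symbol map from the enveloping superalgebra to the supersymmetric algebra. -/
def symb : U k m n →ₗ[k] Fock k (par m n) :=
  (LinearMap.applyₗ vac) ∘ₗ (rep k m n).toLinearMap

theorem symb_apply (u : U k m n) : symb k m n u = rep k m n u vac := rfl

/-- The Poincaré–Birkhoff–Witt theorem. -/
theorem symb_injective : Function.Injective (symb k m n) := by
  -- Compare the symbols of ordered monomials with the monomials themselves, which are linearly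
  -- independent. Since ordered monomials span `U`, injectivity on their formal combinations
  -- suffices.
  have key : Function.Injective (symb k m n ∘ₗ orderedComb k m n) := by
    refine (injective_and_range_eq_of_triangular
      (B := Finsupp.linearCombination k (mono (k := k) (π := par m n)))
      (fun d => Finsupp.supported k k {b | (monoWord k b).length ≤ d}) ?_
      linearCombination_mono_injective ?_ ?_).1
    · intro w
      refine ⟨w.support.sup fun b => (monoWord k b).length, fun b hb => ?_⟩
      exact Finset.le_sup (f := fun b => (monoWord k b).length) hb
    · intro w hw
      rw [Finsupp.supported_eq_span_single] at hw
      induction hw using Submodule.span_induction with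
      | mem w h =>
        obtain ⟨b, hb, rfl⟩ := h
        have hb' : monoWord k b = [] := by simpa using hb
        have := word_monoWord (k := k) b
        rw [hb'] at this
        simp [orderedComb, hb', symb_apply, ← this]
      | zero => simp
      | add x y _ _ hx hy => rw [map_add, map_add, hx, hy]
      | smul c x _ hx => rw [map_smul, map_smul, hx]
    · intro d w hw
      have h1 : deg k (par m n) d ≤ (Finsupp.supported k k {b | (monoWord k b).length ≤ d}).map
          (Finsupp.linearCombination k (mono (k := k) (π := par m n))) := by
        rw [deg, Submodule.span_le]
        rintro _ ⟨l, hl, rfl⟩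
        rcases word_eq_smul_mono (k := k) (π := par m n) l with h | ⟨c, b, hb, h⟩
        · rw [h]; exact zero_mem _
        · refine ⟨Finsupp.single b c, Finsupp.single_mem_supported k c ?_, by simp [h]⟩
          exact (length_monoWord hb).trans_le hl
      have h2 : symb k m n (orderedComb k m n w) -
          Finsupp.linearCombination k (mono (k := k) (π := par m n)) w ∈ deg k (par m n) d := by
        rw [Finsupp.supported_eq_span_single] at hw
        induction hw using Submodule.span_induction with
        | mem w h =>
          obtain ⟨b, hb, rfl⟩ := h
          have := rep_uword_sub_mem_deg (k := k) (monoWord k b) d hb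
          rw [word_monoWord] at this
          simpa [orderedComb, symb_apply] using this
        | zero => simp
        | add x y _ _ hx hy =>
          rw [map_add, map_add, map_add, add_sub_add_comm]
          exact add_mem hx hy
        | smul c x _ hx =>
          rw [map_smul, map_smul, map_smul, ← smul_sub]
          exact Submodule.smul_mem _ c hx
      obtain ⟨w', hw', h⟩ := h1 h2
      exact ⟨w', hw', by rw [h, LinearMap.comp_apply]; abel⟩
  intro u v h
  obtain ⟨u, rfl⟩ := orderedComb_surjective u
  obtain ⟨v, rfl⟩ := orderedComb_surjective v
  exact congrArg _ (key h)

end SuperCurrent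

/-! ### Elements without odd variables, and polynomials with vanishing derivatives. -/

namespace SuperCurrent

namespace Fock

variable {k : Type*} [Field k] {I : Type*} [DecidableEq I] [Encodable I] {π : I → ZMod 2}

theorem coeff_oddD (u : {t // π t ≠ 0}) {F : Finset {t // π t ≠ 0}} (hu : u ∈ F) (f : Fock k π) :
    coeff (F.erase u) (oddD u f) = (-1 : k) ^ below u F • coeff F f := by
  induction f using Fock.induction_linear with
  | zero => simp
  | add f g hf hg => simp only [map_add, hf, hg, smul_add]
  | single G g =>
    by_cases hG : u ∈ G
    · have h : G.erase u = F.erase u ↔ G = F :=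
        ⟨fun h => by rw [← Finset.insert_erase hG, h, Finset.insert_erase hu], fun h => by rw [h]⟩
      by_cases hGF : G = F
      · subst hGF; simp [oddD_single, hG, coeff_single]
      · simp [oddD_single, hG, coeff_single, h, hGF]
    · have : G ≠ F := fun h => hG (h ▸ hu)
      simp [oddD_single, hG, coeff_single, this]

/-- For nonempty `F` and `u ∈ F`, the coefficient of `F` in `f` reappears up to sign as the
coefficient of `F.erase u` in `D u f`. -/
theorem eq_single_of_D_eq_zero {f : Fock k π} (h : ∀ t, π t ≠ 0 → D t f = 0) :
    f = single ∅ (coeff ∅ f) := by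
  refine ext_coeff fun F => ?_
  rw [coeff_single]
  split_ifs with hF
  · rw [hF]
  · obtain ⟨u, hu⟩ := Finset.nonempty_iff_ne_empty.2 (Ne.symm hF)
    have h1 := coeff_oddD u hu f
    have h2 := h u.1 u.2
    rw [D, dif_neg u.2] at h2
    rw [h2, map_zero] at h1
    exact (smul_eq_zero.1 h1.symm).resolve_left (pow_ne_zero _ (neg_ne_zero.2 one_ne_zero))

theorem single_injective (F : Finset {t // π t ≠ 0}) :
    Function.Injective (single (k := k) F) := fun g g' h => by
  have := congrArg (coeff F) h
  simpa [coeff_single] using this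

theorem D_single_empty {t : I} (ht : π t = 0) (g : MvPolynomial {t // π t = 0} k) :
    D t (single ∅ g) = single ∅ (MvPolynomial.pderiv ⟨t, ht⟩ g) := by
  rw [D, dif_pos ht, evD_single]

theorem X_single_empty {t : I} (ht : π t = 0) (g : MvPolynomial {t // π t = 0} k) :
    X t (single ∅ g) = single ∅ (MvPolynomial.X ⟨t, ht⟩ * g) := by
  rw [X, dif_pos ht, evX_single]

end Fock

section PowerSubstitution

open MvPolynomial

variable {k : Type*} [Field k] {σ : Type*} (d : σ → ℕ)

/-- The multiplication of the exponents of a monomial by `d`. -/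
def scale (a : σ →₀ ℕ) : σ →₀ ℕ :=
  Finsupp.onFinset a.support (fun i => a i * d i) fun i hi => by
    simp only [ne_eq, mul_eq_zero, not_or] at hi
    simpa using hi.1

@[simp] theorem scale_apply (a : σ →₀ ℕ) (i : σ) : scale d a i = a i * d i := rfl

/-- The substitution `X i ↦ X i ^ d i`. -/
def powSubst : MvPolynomial σ k →ₐ[k] MvPolynomial σ k := aeval fun i => X i ^ d i

theorem powSubst_monomial (a : σ →₀ ℕ) (c : k) :
    powSubst d (monomial a c) = monomial (scale d a) c := by
  rw [powSubst, aeval_monomial, monomial_eq (s := scale d a), algebraMap_eq]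
  congr 1
  rw [Finsupp.prod, Finsupp.prod_of_support_subset (s := a.support)]
  · exact Finset.prod_congr rfl fun i _ => by rw [← pow_mul, scale_apply, mul_comm]
  · intro i hi
    simp only [Finsupp.mem_support_iff, scale_apply, ne_eq, mul_eq_zero, not_or] at hi ⊢
    exact hi.1
  · simp

variable {d}

theorem scale_injective (hd : ∀ i, d i ≠ 0) : Function.Injective (scale d) := fun a b h => by
  ext i
  have := DFunLike.congr_fun h i
  exact Nat.eq_of_mul_eq_mul_right (Nat.pos_of_ne_zero (hd i)) this

theorem coeff_powSubst (hd : ∀ i, d i ≠ 0) (a : σ →₀ ℕ) (f : MvPolynomial σ k) :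
    MvPolynomial.coeff (scale d a) (powSubst d f) = MvPolynomial.coeff a f := by
  classical
  induction f using MvPolynomial.induction_on' with
  | monomial b c =>
    rw [powSubst_monomial, coeff_monomial, coeff_monomial]
    simp only [(scale_injective hd).eq_iff]
  | add f g hf hg => rw [map_add, coeff_add, coeff_add, hf, hg]

theorem powSubst_injective (hd : ∀ i, d i ≠ 0) :
    Function.Injective (powSubst (k := k) d) := fun f g h => by
  ext a
  rw [← coeff_powSubst hd a f, h, coeff_powSubst hd]

theorem mem_range_powSubst {f : MvPolynomial σ k}
    (h : ∀ b, MvPolynomial.coeff b f ≠ 0 → ∀ i, d i ∣ b i) : f ∈ (powSubst (k := k) d).range := by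
  rw [← support_sum_monomial_coeff f]
  refine sum_mem fun b hb => ?_
  have hb' := h b (by simpa using hb)
  refine ⟨monomial (Finsupp.onFinset b.support (fun i => b i / d i) fun i hi => ?_)
    (MvPolynomial.coeff b f), ?_⟩
  · simp only [Finsupp.mem_support_iff]
    intro h0
    simp [h0] at hi
  · change powSubst d _ = _
    rw [powSubst_monomial]
    exact congrArg (fun a => monomial a _) (Finsupp.ext fun i => Nat.div_mul_cancel (hb' i))

/-- The coefficient of `b` with its `i`-th exponent lowered by one in the derivative is `b i` times
that of `b` in `f`, so `b i` is zero in `k`. -/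
theorem dvd_of_pderiv_eq_zero (p : ℕ) [CharP k p] {f : MvPolynomial σ k} {i : σ}
    (h : pderiv i f = 0) {b : σ →₀ ℕ} (hb : MvPolynomial.coeff b f ≠ 0) : p ∣ b i := by
  classical
  by_cases h0 : b i = 0
  · simp [h0]
  have h1 := congrArg (MvPolynomial.coeff (b - Finsupp.single i 1)) h
  have h2 : b - Finsupp.single i 1 + Finsupp.single i 1 = b :=
    tsub_add_cancel_of_le (by simpa using Nat.one_le_iff_ne_zero.2 h0)
  rw [coeff_pderiv, h2, MvPolynomial.coeff_zero] at h1
  have h3 := (mul_eq_zero.1 h1).resolve_left hb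
  rw [← CharP.cast_eq_zero_iff k p, ← h3]
  have : (b i - 1) + 1 = b i := Nat.sub_add_cancel (Nat.one_le_iff_ne_zero.2 h0)
  conv_lhs => rw [← this]
  simp

end PowerSubstitution

/-! ### Linear relations among the derivatives of an invariant. -/

open Fock

variable {k : Type*} [Field k] {m n : ℕ}

/-- Evaluates the sum in `D_der` for left multiplication: among the products `e_{i,j} x^s · t`, only
`t = e_{j,b} x^r` can involve `e_{a,b} x^{r+s}`. The next lemma is the right-handed analogue. -/
theorem sum_left {f : Fock k (par m n)} {G : Finset (Idx m n)} (hG : ∀ t ∉ G, D t f = 0)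
    (i j a b : Fin (m + n)) (r s : ℕ) :
    ∑ t ∈ G, (basis k m n).repr (LinearMap.mulLeft k (e k m n i j s) (basis k m n t)) (a, b, r + s) •
      D t f = if i = a then D (j, b, r) f else 0 := by
  rw [Finset.sum_eq_single (j, b, r)]
  · have : e k m n i b (s + r) = basis k m n (i, b, r + s) := by rw [basis_apply, add_comm]
    rw [LinearMap.mulLeft_apply, basis_apply, e_mul_e, if_pos rfl, this, Module.Basis.repr_self]
    by_cases h : i = a
    · simp [h]
    · rw [Finsupp.single_eq_of_ne (by simpa using Ne.symm h)]
      simp [h]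
  · rintro ⟨t1, t2, t3⟩ _ ht
    rw [LinearMap.mulLeft_apply, basis_apply, e_mul_e]
    dsimp only
    split_ifs with h
    · have : e k m n i t2 (s + t3) = basis k m n (i, t2, s + t3) := by rw [basis_apply]
      rw [this, Module.Basis.repr_self, Finsupp.single_eq_of_ne, zero_smul]
      intro h'
      simp only [Prod.mk.injEq] at h'
      refine ht ?_
      rw [h, h'.2.1, show t3 = r by omega]
    · simp
  · intro h
    rw [hG _ h, smul_zero]

theorem sum_right {f : Fock k (par m n)} {G : Finset (Idx m n)} (hG : ∀ t ∉ G, D t f = 0)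
    (c : ZMod 2) (i j a b : Fin (m + n)) (r s : ℕ) :
    ∑ t ∈ G, (basis k m n).repr (rmul c (e k m n i j s) (basis k m n t)) (a, b, r + s) •
      D t f = if j = b then sgn k c (par m n (a, i, r)) • D (a, i, r) f else 0 := by
  rw [Finset.sum_eq_single (a, i, r)]
  · have : e k m n a j (r + s) = basis k m n (a, j, r + s) := by rw [basis_apply]
    rw [rmul_basis, basis_apply, e_mul_e, if_pos rfl, this, map_smul, Module.Basis.repr_self]
    by_cases h : j = b
    · simp [h]
    · rw [Finsupp.smul_apply, Finsupp.single_eq_of_ne (by simpa using Ne.symm h)]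
      simp [h]
  · rintro ⟨t1, t2, t3⟩ _ ht
    rw [rmul_basis, basis_apply, e_mul_e]
    dsimp only
    split_ifs with h
    · have : e k m n t1 j (t3 + s) = basis k m n (t1, j, t3 + s) := by rw [basis_apply]
      rw [this, map_smul, Finsupp.smul_apply, Module.Basis.repr_self, Finsupp.single_eq_of_ne,
        smul_zero, zero_smul]
      intro h'
      simp only [Prod.mk.injEq] at h'
      refine ht ?_
      rw [h, h'.1, show t3 = r by omega]
    · simp
  · intro h
    rw [hG _ h, smul_zero]

theorem par_diag (i : Fin (m + n)) (r : ℕ) : par m n (i, i, r) = 0 := zmod_two_add_self _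

/-- The superderivations by which an invariant is constrained give relations between its
derivatives. -/
theorem D_relation {f : Fock k (par m n)}
    (h : ∀ (b : ZMod 2) (x : Cur k m n), x ∈ part k m n b →
      der (basis k m n) (LinearMap.mulLeft k x) f = der (basis k m n) (rmul b x) f)
    (i j a b : Fin (m + n)) (r : ℕ) :
    (if i = a then D (j, b, r) f else 0) =
      if j = b then sgn k (parity m n i + parity m n j) (par m n (a, i, r)) • D (a, i, r) f
        else 0 := by
  -- With this `s` no variable carrying `x^(r + s)` occurs in `f`, which is what `D_der` requires.
  -- Arbitrarily high powers of `x` are available only because `g` is a current algebra.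
  set s := (supp f).sup (fun t => t.2.2) + 1 with hs
  have hw : D (a, b, r + s) f = 0 := by
    refine D_eq_zero_of_notMem_supp fun h' => ?_
    have := Finset.le_sup (f := fun t : Idx m n => t.2.2) h'
    simp only at this
    omega
  have h1 := congrArg (D (a, b, r + s)) (h _ _ (e_mem_part i j s))
  have hG : ∀ t ∉ supp f, D t f = 0 := fun t => D_eq_zero_of_notMem_supp
  rwa [D_der _ _ hw hG, D_der _ _ hw hG, sum_left hG, sum_right hG] at h1

/-- Test against `e_{i,i} x^s` at the variable `e_{i,j} x^{r+s}`: the right action contributes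
nothing. -/
theorem D_offdiag {f : Fock k (par m n)}
    (h : ∀ (b : ZMod 2) (x : Cur k m n), x ∈ part k m n b →
      der (basis k m n) (LinearMap.mulLeft k x) f = der (basis k m n) (rmul b x) f)
    {i j : Fin (m + n)} (hij : i ≠ j) (r : ℕ) : D (i, j, r) f = 0 := by
  simpa [hij] using D_relation h i i i j r

/-- Test against `e_{i,j} x^s` at the variable `e_{i,j} x^{r+s}`: both actions contribute one
diagonal derivative, and the sign is trivial since diagonal variables are even. -/
theorem D_diag {f : Fock k (par m n)}
    (h : ∀ (b : ZMod 2) (x : Cur k m n), x ∈ part k m n b →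
      der (basis k m n) (LinearMap.mulLeft k x) f = der (basis k m n) (rmul b x) f)
    (i j : Fin (m + n)) (r : ℕ) : D (i, i, r) f = D (j, j, r) f := by
  simpa [par_diag] using (D_relation h i j i j r).symm

end SuperCurrent

/-! ### Traces as coordinates, and the shape of the invariant polynomials. -/

namespace SuperCurrent

section Coordinates

open MvPolynomial

variable (k : Type*) [Field k] (p m n : ℕ)

/-- The even variables. -/
abbrev EvenIdx (m n : ℕ) : Type := {t : Idx m n // par m n t = 0}

/-- The diagonal even variable. -/
def diag (i : Fin (m + n)) (r : ℕ) : EvenIdx m n := ⟨(i, i, r), par_diag i r⟩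

/-- The coordinate of a diagonal variable other than the first. -/
def diagCoord (i : Fin (m + n)) (r : ℕ) : MvPolynomial (GenIndex m n) k :=
  -- The value 0 at the first index lets `toCoord` subtract a sum over all `i`.
  if h : i.val = 0 then 0 else X (Sum.inr ⟨(i, i, r), par_diag i r, fun h' => h h'.1⟩)

/-- The coordinate change that sends the traces and the other even variables to coordinates. -/
def toCoord : MvPolynomial (EvenIdx m n) k →ₐ[k] MvPolynomial (GenIndex m n) k :=
  aeval fun t => if h : t.1.1.val = 0 ∧ t.1.2.1.val = 0 then
    X (Sum.inl t.1.2.2) - ∑ i, diagCoord k m n i t.1.2.2 else X (Sum.inr ⟨t.1, t.2, h⟩)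

/-- The inverse coordinate change. -/
def ofCoord : MvPolynomial (GenIndex m n) k →ₐ[k] MvPolynomial (EvenIdx m n) k :=
  aeval (Sum.elim (fun r => ∑ i, X (diag m n i r)) fun t => X ⟨t.1, t.2.1⟩)

theorem toCoord_diag_zero (h : 0 < m + n) (r : ℕ) : toCoord k m n (X (diag m n ⟨0, h⟩ r)) =
    X (Sum.inl r) - ∑ i, diagCoord k m n i r := by
  simp [toCoord, diag]

theorem toCoord_diag {i : Fin (m + n)} (hi : i.val ≠ 0) (r : ℕ) :
    toCoord k m n (X (diag m n i r)) = diagCoord k m n i r := by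
  simp [toCoord, diag, diagCoord, hi]

theorem toCoord_X {t : EvenIdx m n} (ht : ¬(t.1.1.val = 0 ∧ t.1.2.1.val = 0)) :
    toCoord k m n (X t) = X (Sum.inr ⟨t.1, t.2, ht⟩) := by
  simp [toCoord, ht]

theorem eq_diag_zero {t : EvenIdx m n} (h : 0 < m + n) (ht : t.1.1.val = 0 ∧ t.1.2.1.val = 0) :
    t = diag m n ⟨0, h⟩ t.1.2.2 := by
  obtain ⟨⟨i, j, r⟩, ht'⟩ := t
  simp only at ht
  simp [diag, Fin.ext_iff, ht.1, ht.2]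

theorem toCoord_comp_ofCoord (h : 0 < m + n) :
    (toCoord k m n).comp (ofCoord k m n) = AlgHom.id k _ := by
  refine algHom_ext fun t => ?_
  rcases t with r | t
  · simp only [AlgHom.comp_apply, ofCoord, aeval_X, Sum.elim_inl, map_sum, AlgHom.id_apply]
    have : ∀ i, toCoord k m n (X (diag m n i r)) = diagCoord k m n i r +
        if i = ⟨0, h⟩ then X (Sum.inl r) - ∑ i, diagCoord k m n i r else 0 := by
      intro i
      split_ifs with hi
      · rw [hi, toCoord_diag_zero, diagCoord, dif_pos rfl, zero_add]
      · rw [toCoord_diag k m n (fun h' => hi (Fin.ext h')), add_zero]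
    simp [this, Finset.sum_add_distrib]
  · simp only [AlgHom.comp_apply, ofCoord, aeval_X, Sum.elim_inr, AlgHom.id_apply]
    exact toCoord_X k m n t.2.2

theorem ofCoord_comp_toCoord (h : 0 < m + n) :
    (ofCoord k m n).comp (toCoord k m n) = AlgHom.id k _ := by
  refine algHom_ext fun t => ?_
  by_cases ht : t.1.1.val = 0 ∧ t.1.2.1.val = 0
  · rw [eq_diag_zero m n h ht, AlgHom.comp_apply, toCoord_diag_zero]
    set r := t.1.2.2
    have : ∀ i, ofCoord k m n (diagCoord k m n i r) =
        X (diag m n i r) - if i = ⟨0, h⟩ then X (diag m n ⟨0, h⟩ r) else 0 := by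
      intro i
      split_ifs with hi
      · simp [hi, diagCoord]
      · have : i.val ≠ 0 := fun h' => hi (Fin.ext h')
        simp [diagCoord, this, ofCoord, diag]
    simp only [map_sub, map_sum, this, Finset.sum_sub_distrib]
    simp [ofCoord]
  · rw [AlgHom.comp_apply, toCoord_X k m n ht]
    simp [ofCoord]

theorem pderiv_diagCoord (t) (i : Fin (m + n)) (r : ℕ) :
    pderiv (Sum.inr t) (diagCoord k m n i r) = if t.1 = (i, i, r) then 1 else 0 := by
  rw [diagCoord]
  split_ifs with h h' h'
  · exact absurd ⟨by rw [h']; exact h, by rw [h']; exact h⟩ t.2.2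
  · simp
  · have : t = ⟨(i, i, r), par_diag i r, fun h' => h h'.1⟩ := Subtype.ext h'
    rw [this, pderiv_X_self]
  · refine pderiv_X_of_ne fun h'' => h' ?_
    rw [← Sum.inr_injective h'']

/-- The chain rule for the coordinate change. -/
theorem pderiv_toCoord (h : 0 < m + n) (t) (g : MvPolynomial (EvenIdx m n) k) :
    pderiv (Sum.inr t) (toCoord k m n g) = toCoord k m n (pderiv ⟨t.1, t.2.1⟩ g -
      if t.1.1 = t.1.2.1 then pderiv (diag m n ⟨0, h⟩ t.1.2.2) g else 0) := by
  induction g using MvPolynomial.induction_on with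
  | C c =>
    rw [← algebraMap_eq, AlgHom.commutes, algebraMap_eq]
    simp
  | add f g hf hg =>
    rw [map_add, map_add, hf, hg, ← map_add]
    congr 1
    split_ifs <;> simp only [map_add] <;> ring
  | mul_X f u hf =>
    have key : pderiv (Sum.inr t) (toCoord k m n (X u)) =
        toCoord k m n (pderiv ⟨t.1, t.2.1⟩ (X u) -
          if t.1.1 = t.1.2.1 then pderiv (diag m n ⟨0, h⟩ t.1.2.2) (X u) else 0) := by
      clear hf f
      classical
      obtain ⟨⟨i, j, r⟩, ht, ht'⟩ := t
      simp only at ht' ⊢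
      by_cases hu : u.1.1.val = 0 ∧ u.1.2.1.val = 0
      · rw [eq_diag_zero m n h hu, toCoord_diag_zero]
        set r' := u.1.2.2
        have h1 : (⟨(i, j, r), ht⟩ : EvenIdx m n) ≠ diag m n ⟨0, h⟩ r' := by
          intro h1
          have h1' := congrArg Subtype.val h1
          simp only [diag, Prod.mk.injEq, Fin.ext_iff] at h1'
          exact ht' ⟨h1'.1, h1'.2.1⟩
        rw [pderiv_X_of_ne h1.symm, map_sub, map_sum, pderiv_X_of_ne (by simp)]
        simp only [pderiv_diagCoord, zero_sub, map_neg]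
        congr 1
        by_cases hij : i = j
        · subst hij
          rw [if_pos rfl]
          by_cases hr : r = r'
          · subst hr
            rw [Finset.sum_eq_single i]
            · simp
            · intro b _ hb
              simp [Ne.symm hb]
            · simp
          · rw [pderiv_X_of_ne (by simp [diag, Ne.symm hr]), map_zero]
            exact Finset.sum_eq_zero fun b _ => by simp [hr]
        · rw [if_neg hij, map_zero]
          refine Finset.sum_eq_zero fun b _ => if_neg fun h' => hij ?_
          simp only [Prod.mk.injEq] at h'
          rw [h'.1, h'.2.1]
      · have h2 : u ≠ diag m n ⟨0, h⟩ r := by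
          rintro rfl
          exact hu ⟨rfl, rfl⟩
        rw [toCoord_X k m n hu, pderiv_X_of_ne h2, ite_self, sub_zero]
        by_cases h3 : u = ⟨(i, j, r), ht⟩
        · subst h3
          simp
        · rw [pderiv_X_of_ne h3, map_zero]
          refine pderiv_X_of_ne fun h' => h3 ?_
          have := Sum.inr_injective h'
          simp only [Subtype.mk.injEq] at this
          exact Subtype.ext this
    rw [map_mul, pderiv_mul, hf, key, ← map_mul, ← map_mul, ← map_add]
    congr 1
    split_ifs <;> simp only [pderiv_mul] <;> ring

/-- The map that sends the coordinates to the traces and the `p`-th powers of the other even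
variables. -/
def invMap : MvPolynomial (GenIndex m n) k →ₐ[k] MvPolynomial (EvenIdx m n) k :=
  (ofCoord k m n).comp (powSubst (Sum.elim (fun _ => 1) fun _ => p))

theorem invMap_inl (r : ℕ) : invMap k p m n (X (Sum.inl r)) = ∑ i, X (diag m n i r) := by
  simp [invMap, powSubst, ofCoord]

theorem invMap_inr (t) : invMap k p m n (X (Sum.inr t)) = X ⟨t.1, t.2.1⟩ ^ p := by
  simp [invMap, powSubst, ofCoord]

theorem invMap_injective (h : 0 < m + n) (hp : p ≠ 0) : Function.Injective (invMap k p m n) := by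
  have h1 : Function.Injective (ofCoord k m n) := fun f g hfg => by
    have := congrArg (toCoord k m n) hfg
    rwa [← AlgHom.comp_apply, ← AlgHom.comp_apply, toCoord_comp_ofCoord k m n h] at this
  refine h1.comp (powSubst_injective fun i => ?_)
  rcases i with r | t
  · exact one_ne_zero
  · exact hp

/-- In the trace coordinates, the derivative along a remaining diagonal variable is the difference
of its old derivative and that of the first one, which vanishes by `h2`; off-diagonal derivatives
are unchanged and vanish by `h1`. So `p` divides every exponent except those of the traces. -/
theorem mem_range_invMap [CharP k p] (h : 0 < m + n) {g : MvPolynomial (EvenIdx m n) k}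
    (h1 : ∀ t : EvenIdx m n, t.1.1 ≠ t.1.2.1 → pderiv t g = 0)
    (h2 : ∀ i j r, pderiv (diag m n i r) g = pderiv (diag m n j r) g) :
    g ∈ (invMap k p m n).range := by
  have h3 : toCoord k m n g ∈
      (powSubst (k := k) (Sum.elim (fun _ => 1) fun _ => p : GenIndex m n → ℕ)).range := by
    refine mem_range_powSubst fun b hb i => ?_
    rcases i with r | t
    · exact one_dvd _
    · refine dvd_of_pderiv_eq_zero p ?_ hb
      rw [pderiv_toCoord k m n h]
      obtain ⟨⟨i, j, r⟩, ht, ht'⟩ := t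
      by_cases hij : i = j
      · subst hij
        have := h2 i ⟨0, h⟩ r
        rw [if_pos rfl, ← this]
        simp [diag]
      · rw [if_neg hij, h1 ⟨(i, j, r), ht⟩ hij]
        simp
  obtain ⟨w, hw⟩ := h3
  refine ⟨w, ?_⟩
  have h4 := AlgHom.congr_fun (ofCoord_comp_toCoord k m n h) g
  rw [AlgHom.comp_apply, ← hw] at h4
  exact h4

end Coordinates

open Fock

variable {k : Type*} [Field k] {m n : ℕ}

/-- The symbol of a central element is a polynomial in the traces and the `p`-th powers. -/
theorem symb_mem_range_of_mem_centerPart (p : ℕ) [CharP k p] (hmn : 0 < m + n) {a : ZMod 2}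
    {u : U k m n} (hu : u ∈ centerPart k m n a) :
    ∃ w, symb k m n u = single ∅ (invMap k p m n w) := by
  have h := fun b x => der_eq_of_mem_centerPart (b := b) (x := x) hu
  have h1 : symb k m n u = single ∅ (coeff ∅ (symb k m n u)) := by
    -- Diagonal variables are even, so every odd one is off-diagonal.
    refine eq_single_of_D_eq_zero fun t ht => ?_
    obtain ⟨i, j, r⟩ := t
    refine D_offdiag h (fun hij => ht ?_) r
    rw [hij, par_diag]
  have h2 : ∀ t : EvenIdx m n, t.1.1 ≠ t.1.2.1 →
      MvPolynomial.pderiv t (coeff ∅ (symb k m n u)) = 0 := fun t ht => by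
    apply single_injective ∅
    rw [← D_single_empty t.2, ← h1, map_zero]
    exact D_offdiag h ht _
  have h3 : ∀ i j r, MvPolynomial.pderiv (diag m n i r) (coeff ∅ (symb k m n u)) =
      MvPolynomial.pderiv (diag m n j r) (coeff ∅ (symb k m n u)) := fun i j r => by
    apply single_injective ∅
    rw [diag, diag, ← D_single_empty, ← D_single_empty, ← h1]
    exact D_diag h i j r
  obtain ⟨w, hw⟩ := mem_range_invMap k p m n hmn h2 h3
  exact ⟨w, h1.trans (congrArg _ hw.symm)⟩

end SuperCurrent

namespace SuperCurrent

/-! ### Frobenius identities and a case of Jacobson's formula. -/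

section Jacobson

variable {k : Type*} [Field k] {p : ℕ} [Fact p.Prime] [CharP k p] {A : Type*} [Ring A] [Algebra k A]

variable (k) in
theorem sub_pow_char_of_algebra (p : ℕ) [Fact p.Prime] [CharP k p] {x y : A} (h : Commute x y) :
    (x - y) ^ p = x ^ p - y ^ p := by
  cases subsingleton_or_nontrivial A
  · exact Subsingleton.elim _ _
  · have : CharP A p := charP_of_injective_algebraMap (FaithfulSMul.algebraMap_injective k A) p
    exact sub_pow_char_of_commute p h

/-- Pascal's rule together with `p ∣ p.choose (i + 1)` flips the sign at each step. -/
theorem neg_one_pow_mul_choose (p : ℕ) [Fact p.Prime] [CharP k p] {i : ℕ} (hi : i < p) :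
    (-1 : k) ^ i * ((p - 1).choose i : k) = 1 := by
  induction i with
  | zero => simp
  | succ i ih =>
    have h1 : p.choose (i + 1) = (p - 1).choose i + (p - 1).choose (i + 1) := by
      conv_lhs => rw [← Nat.sub_add_cancel (Fact.out : p.Prime).one_le]
      exact Nat.choose_succ_succ _ _
    have h2 : (p.choose (i + 1) : k) = 0 :=
      (CharP.cast_eq_zero_iff k p _).2 ((Fact.out : p.Prime).dvd_choose_self (by omega) hi)
    rw [h1, Nat.cast_add] at h2
    have h3 := ih (by omega)
    rw [pow_succ, eq_neg_of_add_eq_zero_right h2]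
    linear_combination h3

variable (k) in
theorem sum_pow_mul_pow_of_algebra (p : ℕ) [Fact p.Prime] [CharP k p] {x y : A} (h : Commute x y) :
    ∑ i ∈ Finset.range p, x ^ i * y ^ (p - 1 - i) = (x - y) ^ (p - 1) := by
  have hp := (Fact.out : p.Prime).one_le
  rw [sub_eq_neg_add, (h.symm.neg_left).add_pow, Nat.sub_add_cancel hp, ← Finset.sum_range_reflect]
  refine Finset.sum_congr rfl fun i hi => ?_
  rw [Finset.mem_range] at hi
  have h1 := congrArg (algebraMap k A) (neg_one_pow_mul_choose (k := k) p hi)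
  rw [map_mul, map_pow, map_neg, map_one, map_natCast] at h1
  rw [neg_pow, show p - 1 - (p - 1 - i) = i by omega, (h.pow_pow _ _).eq, mul_assoc, mul_assoc,
    (Nat.cast_commute _ (x ^ (p - 1 - i))).symm.eq, ← mul_assoc (y ^ i),
    (Nat.cast_commute _ (y ^ i)).symm.eq, mul_assoc, ← mul_assoc, h1, one_mul]

variable (k) in
/-- The inner derivation `x ↦ a x - x a`. -/
def adl (a : A) : Module.End k A := LinearMap.mulLeft k a - LinearMap.mulRight k a

@[simp] theorem adl_apply (a x : A) : adl k a x = a * x - x * a := rfl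

variable (k) in
-- Left and right multiplication by `a` commute, so Frobenius is additive on them.
theorem adl_pow_char (p : ℕ) [Fact p.Prime] [CharP k p] (a : A) : adl k a ^ p = adl k (a ^ p) := by
  rw [adl, sub_pow_char_of_algebra k p (LinearMap.commute_mulLeft_right a a),
    LinearMap.pow_mulLeft, LinearMap.pow_mulRight, adl]

open Polynomial in
theorem derivative_pow_eq_sum (P : A[X]) (n : ℕ) :
    derivative (P ^ n) = ∑ i ∈ Finset.range n, P ^ i * derivative P * P ^ (n - 1 - i) := by
  induction n with
  | zero => simp
  | succ n ih =>
    rw [pow_succ, derivative_mul, ih, Finset.sum_range_succ, Finset.sum_mul]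
    congr 1
    · refine Finset.sum_congr rfl fun i hi => ?_
      rw [Finset.mem_range] at hi
      rw [mul_assoc, ← pow_succ]
      congr 2
      omega
    · simp

open Polynomial in
variable (k) in
/-- Jacobson's formula for `(D + b)^p` if `b` commutes with its iterated commutators with `D`. -/
theorem add_pow_char_of_commute_adl (p : ℕ) [Fact p.Prime] [CharP k p] (D b : A)
    (h : ∀ j, Commute b ((adl k D ^ j) b)) :
    (D + b) ^ p = D ^ p + (adl k D ^ (p - 1)) b + b ^ p := by
  -- Expand `P ^ p` in an auxiliary central variable and set it to 1. The derivative of `P ^ p` is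
  -- `(ad P)^(p-1) b`, which turns out to be constant; this kills all coefficients strictly between
  -- 1 and `p`.
  set P : A[X] := C D + C b * X with hP
  have hder : derivative (P ^ p) = C ((adl k D ^ (p - 1)) b) := by
    -- By `h`, the summand `C b * X` of `P` commutes with every iterated commutator.
    have h1 : ∀ j, (adl k P ^ j) (C b) = C ((adl k D ^ j) b) := by
      intro j
      induction j with
      | zero => simp
      | succ j ih =>
        rw [pow_succ', Module.End.mul_apply, ih, pow_succ', Module.End.mul_apply, adl_apply,
          adl_apply, hP, add_mul, mul_add, mul_assoc, X_mul_C, ← mul_assoc, ← mul_assoc, ← C_mul,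
          ← C_mul, ← C_mul, ← C_mul, (h j).eq, C_sub]
        abel
    have h2 : derivative P = C b := by simp [hP]
    rw [derivative_pow_eq_sum, h2, ← h1, adl,
      ← sum_pow_mul_pow_of_algebra k p (LinearMap.commute_mulLeft_right P P),
      LinearMap.sum_apply]
    refine Finset.sum_congr rfl fun i _ => ?_
    rw [LinearMap.pow_mulLeft, LinearMap.pow_mulRight, Module.End.mul_apply,
      LinearMap.mulRight_apply, LinearMap.mulLeft_apply, mul_assoc]
  have hdeg : P.natDegree ≤ 1 := by
    rw [hP]
    refine (natDegree_add_le _ _).trans ?_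
    simp only [natDegree_C, zero_le, sup_of_le_right]
    exact (natDegree_C_mul_le _ _).trans natDegree_X_le
  have hdegp : (P ^ p).natDegree < p + 1 :=
    Nat.lt_succ_of_le (natDegree_pow_le.trans (by simpa using Nat.mul_le_mul_left p hdeg))
  have c0 : (P ^ p).coeff 0 = D ^ p := by
    change constantCoeff (P ^ p) = _
    rw [map_pow]
    simp [hP]
  have c1 : (P ^ p).coeff 1 = (adl k D ^ (p - 1)) b := by
    have := congrArg (fun f => f.coeff 0) hder
    simpa [coeff_derivative] using this
  have cp : (P ^ p).coeff p = b ^ p := by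
    have := coeff_pow_of_natDegree_le (m := p) hdeg
    rw [mul_one] at this
    rw [this]
    simp [hP]
  -- The factor `i + 2` produced by differentiation is invertible in `k`, being less than `p`.
  have ci : ∀ i, i + 2 < p → (P ^ p).coeff (i + 2) = 0 := by
    intro i hi
    have h1 := congrArg (fun f => f.coeff (i + 1)) hder
    simp only [coeff_derivative, coeff_C_succ] at h1
    have h2 : ((i + 2 : ℕ) : k) ≠ 0 := by
      rw [ne_eq, CharP.cast_eq_zero_iff k p]
      exact fun h => absurd (Nat.le_of_dvd (by omega) h) (by omega)
    have h3 : (((i + 2 : ℕ) : k)) • (P ^ p).coeff (i + 2) = 0 := by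
      rw [Algebra.smul_def, map_natCast, (Nat.cast_commute _ _).eq, ← h1]
      push_cast
      congr 1
      rw [add_assoc]
      congr 1
      norm_num
    exact (smul_eq_zero.1 h3).resolve_left h2
  let ev : A[X] →+* A := eval₂RingHom' (RingHom.id A) 1 fun a => Commute.one_right a
  have hev : ev P = D + b := by
    simp [ev, hP]
  have hsum : ev (P ^ p) = ∑ i ∈ Finset.range (p + 1), (P ^ p).coeff i := by
    change eval₂ (RingHom.id A) 1 (P ^ p) = _
    rw [eval₂_eq_sum_range' _ hdegp]
    simp
  rw [map_pow, hev] at hsum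
  rw [hsum]
  obtain ⟨q, hq⟩ : ∃ q, p = q + 2 :=
    ⟨p - 2, (Nat.sub_add_cancel (Fact.out : p.Prime).two_le).symm⟩
  rw [Finset.sum_range_succ, cp]
  have : Finset.range p = Finset.range (q + 2) := by rw [← hq]
  rw [this, Finset.sum_range_succ', Finset.sum_range_succ', zero_add, c0, c1,
    Finset.sum_eq_zero fun i hi => ci i (by rw [Finset.mem_range] at hi; omega), zero_add,
    add_comm (D ^ p)]

end Jacobson

/-! ### The `p`-center and the traces are central. -/

open Fock

variable {k : Type*} [Field k] {m n : ℕ}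

theorem der_adl_pow {y : Cur k m n} (hy : y ∈ part k m n 0) (v : Cur k m n) (j : ℕ) :
    (adl k (der (basis k m n) (LinearMap.mulLeft k y) : Module.End k (Fock k (par m n))) ^ j)
      (mul (basis k m n) v) = mul (basis k m n) (y ^ j * v) := by
  induction j with
  | zero => simp
  | succ j ih =>
    rw [pow_succ', Module.End.mul_apply, ih, adl_apply,
      der_mul_mul_of_even (isHomog_mulLeft hy), LinearMap.mulLeft_apply, pow_succ', mul_assoc]
    abel

theorem pow_succ_mem_part {y : Cur k m n} (hy : y ∈ part k m n 0) (j : ℕ) :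
    y ^ (j + 1) ∈ part k m n 0 := by
  induction j with
  | zero => simpa using hy
  | succ j ih => rw [pow_succ]; simpa using mul_mem_part ih hy

theorem pow_mem_part {y : Cur k m n} (hy : y ∈ part k m n 0) {j : ℕ} (hj : j ≠ 0) :
    y ^ j ∈ part k m n 0 := by
  obtain ⟨i, rfl⟩ := Nat.exists_eq_succ_of_ne_zero hj
  exact pow_succ_mem_part hy i

/-- The `p`-th power of an even derivation is again a derivation. By `adl_pow_char`, both sides have
the same commutators with the variables, and both kill the unit. -/
theorem der_pow_char (p : ℕ) [Fact p.Prime] [CharP k p] {y : Cur k m n} (hy : y ∈ part k m n 0) :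
    (der (basis k m n) (LinearMap.mulLeft k y) : Module.End k (Fock k (par m n))) ^ p =
      der (basis k m n) (LinearMap.mulLeft k (y ^ p)) := by
  have hp := (Fact.out : p.Prime).ne_zero
  rw [← sub_eq_zero]
  refine eq_zero_of_comm (fun _ => 1) (fun t => ?_) ?_
  · have h1 := der_adl_pow hy (basis k m n t) p
    have h2 := der_mul_mul_of_even (π := par m n) (isHomog_mulLeft (pow_mem_part hy hp))
      (basis k m n t)
    rw [adl_pow_char, adl_apply, sub_eq_iff_eq_add] at h1
    rw [mul_basis] at h1 h2
    rw [sub_mul, mul_sub, h1, h2, LinearMap.mulLeft_apply, one_smul]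
    abel
  · obtain ⟨q, rfl⟩ := Nat.exists_eq_succ_of_ne_zero hp
    rw [LinearMap.sub_apply, pow_succ, Module.End.mul_apply, der_vac, der_vac, map_zero, sub_zero]

/-- The element `y^p - y^{[p]}` acts as the `p`-th power of the multiplication by `y`. -/
theorem rep_pow_sub (p : ℕ) [Fact p.Prime] [CharP k p] {y : Cur k m n} (hy : y ∈ part k m n 0) :
    rep k m n (ι k m n y ^ p - ι k m n (y ^ p)) = mul (basis k m n) y ^ p := by
  have hp := (Fact.out : p.Prime).ne_zero
  have hcomm : ∀ j, Commute (mul (basis k m n) y : Module.End k (Fock k (par m n)))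
      ((adl k (der (basis k m n) (LinearMap.mulLeft k y)) ^ j) (mul (basis k m n) y)) := by
    intro j
    have h1 := pow_succ_mem_part hy j
    rw [part_eq_homog] at h1 hy
    rw [der_adl_pow (by rwa [part_eq_homog]), ← pow_succ]
    have := mul_mul_mul (k := k) _ hy h1
    rwa [sgn_zero_left, one_smul] at this
  -- Jacobson's formula applies to the derivation and the multiplication by `y`. Its middle term is
  -- multiplication by `y^(p-1) * y`, so it and the derivation of `y ^ p` together are exactly the
  -- action of `y ^ p`.
  rw [map_sub, map_pow, rep_ι, rep_ι, act_apply, act_apply,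
    add_comm (mul (basis k m n) y), add_pow_char_of_commute_adl k p _ _ hcomm, der_adl_pow hy,
    ← pow_succ, Nat.sub_add_cancel (Nat.one_le_iff_ne_zero.2 hp), der_pow_char p hy]
  abel

theorem ι_comm_of_even {y : Cur k m n} (hy : y ∈ part k m n 0) (x : Cur k m n) :
    ι k m n y * ι k m n x - ι k m n x * ι k m n y = ι k m n (y * x - x * y) := by
  have h : adl k (ι k m n y) ∘ₗ ι k m n = ι k m n ∘ₗ adl k y := by
    refine (basis k m n).ext fun t => ?_
    have h := ι_comm hy (basis_mem_part t)
    rwa [bracket_of_mem hy (basis_mem_part t), sgn_zero_left, one_smul, one_smul] at h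
  exact LinearMap.congr_fun h x

/-- The identity `ad(y)^p = ad(y^p)` holds both in `U` and in the matrix algebra over `k[x]`, and
the two sides are intertwined by `ι`. -/
theorem ι_pow_char_comm (p : ℕ) [Fact p.Prime] [CharP k p] {y : Cur k m n}
    (hy : y ∈ part k m n 0) (x : Cur k m n) :
    Commute (ι k m n y ^ p - ι k m n (y ^ p)) (ι k m n x) := by
  have h1 : ∀ j, (adl k (ι k m n y) ^ j) (ι k m n x) = ι k m n ((adl k y ^ j) x) := by
    intro j
    induction j with
    | zero => simp
    | succ j ih =>
      rw [pow_succ', Module.End.mul_apply, ih, adl_apply, ι_comm_of_even hy, pow_succ',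
        Module.End.mul_apply, adl_apply]
  have h2 := h1 p
  rw [adl_pow_char, adl_pow_char, adl_apply, adl_apply,
    ← ι_comm_of_even (pow_mem_part hy (Fact.out : p.Prime).ne_zero)] at h2
  rw [commute_iff_eq, sub_mul, mul_sub, sub_eq_sub_iff_sub_eq_sub, h2]

theorem mul_mem_UPart {a b : ZMod 2} {u v : U k m n} (hu : u ∈ UPart k m n a)
    (hv : v ∈ UPart k m n b) : u * v ∈ UPart k m n (a + b) := by
  induction hu using Submodule.span_induction with
  | mem u h =>
    obtain ⟨l, rfl, rfl⟩ := h
    induction hv using Submodule.span_induction with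
    | mem v h =>
      obtain ⟨l', rfl, rfl⟩ := h
      exact Submodule.subset_span ⟨l ++ l', by simp, by simp⟩
    | zero => simp
    | add x y _ _ hx hy => rw [mul_add]; exact add_mem hx hy
    | smul c x _ hx => rw [mul_smul_comm]; exact Submodule.smul_mem _ c hx
  | zero => simp
  | add x y _ _ hx hy => rw [add_mul]; exact add_mem hx hy
  | smul c x _ hx => rw [smul_mul_assoc]; exact Submodule.smul_mem _ c hx

theorem ι_mem_UPart {a : ZMod 2} {x : Cur k m n} (hx : x ∈ part k m n a) :
    ι k m n x ∈ UPart k m n a := by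
  induction hx using Submodule.span_induction with
  | mem x h =>
    obtain ⟨i, j, r, rfl, rfl⟩ := h
    exact Submodule.subset_span ⟨[(i, j, r)], by simp, by simp⟩
  | zero => simp
  | add x y _ _ hx hy => rw [map_add]; exact add_mem hx hy
  | smul c x _ hx => rw [map_smul]; exact Submodule.smul_mem _ c hx

theorem one_mem_UPart : (1 : U k m n) ∈ UPart k m n 0 :=
  Submodule.subset_span ⟨[], by simp, by simp⟩

theorem mem_centerPart_zero {u : U k m n} :
    u ∈ centerPart k m n 0 ↔ u ∈ UPart k m n 0 ∧ ∀ x, Commute u (ι k m n x) := by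
  refine and_congr_right fun _ => ⟨fun h x => ?_, fun h b x _ => ?_⟩
  · induction x using basis_induction (basis k m n) with
    | zero => simp
    | add x y hx hy => rw [map_add]; exact hx.add_right hy
    | smul c t =>
      rw [map_smul]
      refine Commute.smul_right ?_ c
      have := h _ _ (basis_mem_part t)
      rwa [sgn_zero_left, one_smul] at this
  · rw [sgn_zero_left, one_smul]
    exact h x

variable (k m n) in
/-- The even part of the center as a subalgebra. -/
def evenCenter : Subalgebra k (U k m n) where
  carrier := centerPart k m n 0
  mul_mem' := by
    intro u v hu hv
    rw [SetLike.mem_coe, mem_centerPart_zero] at *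
    exact ⟨by simpa using mul_mem_UPart hu.1 hv.1, fun x => (hu.2 x).mul_left (hv.2 x)⟩
  add_mem' := add_mem
  algebraMap_mem' c := by
    rw [SetLike.mem_coe, mem_centerPart_zero, Algebra.algebraMap_eq_smul_one]
    exact ⟨Submodule.smul_mem _ c one_mem_UPart, fun x => (Commute.one_left _).smul_left c⟩

theorem mem_evenCenter {u : U k m n} :
    u ∈ evenCenter k m n ↔ u ∈ UPart k m n 0 ∧ ∀ x, Commute u (ι k m n x) := mem_centerPart_zero

theorem evenCenter_le_center : evenCenter k m n ≤ Subalgebra.center k (U k m n) := by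
  intro u hu
  rw [mem_evenCenter] at hu
  rw [Subalgebra.mem_center_iff]
  intro v
  have hv : v ∈ Submodule.span k (Set.range (uword (k := k) (m := m) (n := n))) := by
    rw [span_uword_eq_top]; trivial
  induction hv using Submodule.span_induction with
  | mem v h =>
    obtain ⟨l, rfl⟩ := h
    induction l with
    | nil => simp
    | cons t l ih => rw [uword_cons, mul_assoc, ih, ← mul_assoc, ← (hu.2 _).eq, mul_assoc]
  | zero => simp
  | add x y _ _ hx hy => rw [mul_add, add_mul, hx, hy]
  | smul c x _ hx => rw [mul_smul_comm, smul_mul_assoc, hx]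

theorem pow_sub_mem_evenCenter (p : ℕ) [Fact p.Prime] [CharP k p] {y : Cur k m n}
    (hy : y ∈ part k m n 0) : ι k m n y ^ p - ι k m n (y ^ p) ∈ evenCenter k m n := by
  rw [mem_evenCenter]
  refine ⟨sub_mem ?_ (ι_mem_UPart (pow_mem_part hy (Fact.out : p.Prime).ne_zero)),
    ι_pow_char_comm p hy⟩
  have : ∀ j, ι k m n y ^ j ∈ UPart k m n 0 := by
    intro j
    induction j with
    | zero => simpa using one_mem_UPart
    | succ j ih => rw [pow_succ]; simpa using mul_mem_UPart ih (ι_mem_UPart hy)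
  exact this p

variable (k m n) in
/-- The element `e_{1,1} x^r + ⋯ + e_{m+n,m+n} x^r`. -/
def zvec (r : ℕ) : Cur k m n := ∑ i, e k m n i i r

theorem zvec_mem_part (r : ℕ) : zvec k m n r ∈ part k m n 0 :=
  sum_mem fun i _ => by simpa [zmod_two_add_self] using e_mem_part (k := k) i i r

theorem zvec_mul_e (r : ℕ) (i j : Fin (m + n)) (s : ℕ) :
    zvec k m n r * e k m n i j s = e k m n i j (r + s) := by
  simp [zvec, Finset.sum_mul, e_mul_e]

theorem e_mul_zvec (r : ℕ) (i j : Fin (m + n)) (s : ℕ) :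
    e k m n i j s * zvec k m n r = e k m n i j (s + r) := by
  simp [zvec, Finset.mul_sum, e_mul_e]

theorem zvec_mul_zvec (r s : ℕ) : zvec k m n r * zvec k m n s = zvec k m n (r + s) := by
  conv_lhs => rw [zvec, zvec, ← zvec, Finset.mul_sum]
  simp only [zvec_mul_e]
  rfl

theorem z_mem_evenCenter (r : ℕ) : z k m n r ∈ evenCenter k m n := by
  rw [mem_evenCenter]
  refine ⟨ι_mem_UPart (zvec_mem_part r), fun x => ?_⟩
  rw [commute_iff_eq, ← sub_eq_zero]
  refine (ι_comm_of_even (zvec_mem_part r) x).trans ?_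
  have : zvec k m n r * x = x * zvec k m n r := by
    induction x using basis_induction (basis k m n) with
    | zero => simp
    | add x y hx hy => rw [mul_add, add_mul, hx, hy]
    | smul c t =>
      rw [mul_smul_comm, smul_mul_assoc, basis_apply, zvec_mul_e, e_mul_zvec, add_comm r]
  rw [this, sub_self, map_zero]

end SuperCurrent

/-! ### Symbols of the generators, triangularity and the theorem. -/

namespace SuperCurrent

open Fock

variable {k : Type*} [Field k] {m n : ℕ}

theorem e_self_pow (i : Fin (m + n)) (r : ℕ) {q : ℕ} (hq : q ≠ 0) :
    e k m n i i r ^ q = e k m n i i (r * q) := by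
  obtain ⟨j, rfl⟩ := Nat.exists_eq_succ_of_ne_zero hq
  clear hq
  induction j with
  | zero => simp
  | succ j ih => rw [pow_succ, ih, e_mul_e, if_pos rfl, ← Nat.mul_succ]

theorem e_pow_of_ne {i j : Fin (m + n)} (hij : i ≠ j) (r : ℕ) {q : ℕ} (hq : 2 ≤ q) :
    e k m n i j r ^ q = 0 := by
  obtain ⟨l, rfl⟩ := Nat.exists_eq_add_of_le hq
  rw [pow_add, pow_two, e_mul_e, if_neg hij.symm, zero_mul]

/-- The Kronecker delta in `gen` is the `p`-map: diagonal matrix units are idempotent, off-diagonal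
ones square to zero. -/
theorem gen_inr (p : ℕ) [Fact p.Prime] (t) : gen k m n p (Sum.inr t) =
    ι k m n (basis k m n t.1) ^ p - ι k m n (basis k m n t.1 ^ p) := by
  obtain ⟨⟨i, j, r⟩, ht⟩ := t
  rw [basis_apply]
  change ι k m n (e k m n i j r) ^ p - (if i = j then ι k m n (e k m n i j (r * p)) else 0) = _
  congr 1
  split_ifs with h
  · subst h
    rw [e_self_pow i r (Fact.out : p.Prime).ne_zero]
  · rw [e_pow_of_ne h r (Fact.out : p.Prime).two_le, map_zero]

theorem basis_mem_part_zero {t : Idx m n} (ht : par m n t = 0) : basis k m n t ∈ part k m n 0 :=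
  ht ▸ basis_mem_part t

theorem gen_mem_evenCenter (p : ℕ) [Fact p.Prime] [CharP k p] (t : GenIndex m n) :
    gen k m n p t ∈ evenCenter k m n := by
  rcases t with r | t
  · exact z_mem_evenCenter r
  · rw [gen_inr]
    exact pow_sub_mem_evenCenter p (basis_mem_part_zero t.2.1)

variable (k m n) in
/-- The homomorphism from the polynomial algebra to the enveloping superalgebra given by the
generators of the center. -/
def genHom (p : ℕ) [Fact p.Prime] [CharP k p] : MvPolynomial (GenIndex m n) k →ₐ[k] U k m n :=
  -- Evaluation of polynomials needs a commutative target, so it takes place in the ordinary center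
  -- of `U`.
  (Subalgebra.center k (U k m n)).val.comp
    (MvPolynomial.aeval fun t => ⟨gen k m n p t, evenCenter_le_center (gen_mem_evenCenter p t)⟩)

variable (p : ℕ) [Fact p.Prime] [CharP k p]

theorem genHom_X (t : GenIndex m n) : genHom k m n p (MvPolynomial.X t) = gen k m n p t := by
  simp [genHom]

theorem genHom_mem_evenCenter (w : MvPolynomial (GenIndex m n) k) :
    genHom k m n p w ∈ evenCenter k m n := by
  induction w using MvPolynomial.induction_on with
  | C c =>
    rw [← MvPolynomial.algebraMap_eq, AlgHom.commutes]
    exact Subalgebra.algebraMap_mem _ c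
  | add f g hf hg => rw [map_add]; exact add_mem hf hg
  | mul_X f t hf => rw [map_mul, genHom_X]; exact mul_mem hf (gen_mem_evenCenter p t)

variable (k m n) in
/-- The polynomials in the traces and the `p`-th powers, in the supersymmetric algebra. -/
def invLin : MvPolynomial (GenIndex m n) k →ₗ[k] Fock k (par m n) :=
  single ∅ ∘ₗ (invMap k p m n).toLinearMap

theorem invLin_apply (w : MvPolynomial (GenIndex m n) k) :
    invLin k m n p w = single ∅ (invMap k p m n w) := rfl

theorem X_pow_single_empty {t : Idx m n} (ht : par m n t = 0) (q : ℕ)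
    (g : MvPolynomial (EvenIdx m n) k) :
    (X t ^ q) (single ∅ g) = single ∅ (MvPolynomial.X ⟨t, ht⟩ ^ q * g) := by
  induction q with
  | zero => simp
  | succ q ih =>
    rw [pow_succ', Module.End.mul_apply, ih, X_single_empty ht, pow_succ', mul_assoc]

theorem X_pow_invLin (t) (w : MvPolynomial (GenIndex m n) k) :
    (X t.1 ^ p) (invLin k m n p w) = invLin k m n p (MvPolynomial.X (Sum.inr t) * w) := by
  have h : par m n t.1 = 0 := t.2.1
  rw [invLin_apply, X_pow_single_empty h, invLin_apply, map_mul (invMap k p m n), invMap_inr]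

theorem zvec_eq_sum (r : ℕ) : zvec k m n r = ∑ i, basis k m n (i, i, r) := by
  simp [zvec]

theorem mul_zvec_invLin (r : ℕ) (w : MvPolynomial (GenIndex m n) k) :
    mul (basis k m n) (zvec k m n r) (invLin k m n p w) =
      invLin k m n p (MvPolynomial.X (Sum.inl r) * w) := by
  rw [invLin_apply, invLin_apply, map_mul, invMap_inl, zvec_eq_sum, map_sum, LinearMap.sum_apply,
    Finset.sum_mul, map_sum]
  refine Finset.sum_congr rfl fun i _ => ?_
  rw [mul_basis, X_single_empty (par_diag i r)]
  rfl

theorem rep_gen_inr (t) : rep k m n (gen k m n p (Sum.inr t)) = X t.1 ^ p := by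
  rw [gen_inr, rep_pow_sub p (basis_mem_part_zero t.2.1), mul_basis]

theorem rep_z (r : ℕ) : rep k m n (z k m n r) = mul (basis k m n) (zvec k m n r) +
    der (basis k m n) (LinearMap.mulLeft k (zvec k m n r)) :=
  rep_ι _

/-- Both `z_r` and the generator acting as `X t ^ p` are central, so their actions commute;
subtracting the multiplication part of `z_r` leaves the derivation. -/
theorem der_zvec_comm_X_pow (r : ℕ) (t : {t : Fin (m + n) × Fin (m + n) × ℕ //
    parity m n t.1 + parity m n t.2.1 = 0 ∧ ¬(t.1.val = 0 ∧ t.2.1.val = 0)}) :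
    Commute (der (basis k m n) (LinearMap.mulLeft k (zvec k m n r)) :
      Module.End k (Fock k (par m n))) (X t.1 ^ p) := by
  have h1 : Commute (rep k m n (z k m n r)) (rep k m n (gen k m n p (Sum.inr t))) := by
    have h := evenCenter_le_center (gen_mem_evenCenter (k := k) p (Sum.inr t))
    rw [Subalgebra.mem_center_iff] at h
    rw [commute_iff_eq, ← map_mul, ← map_mul, h]
  rw [rep_gen_inr, rep_z] at h1
  have h2 : Commute (mul (basis k m n) (zvec k m n r)) (X t.1 ^ p : Module.End k (Fock k (par m n))) := by
    refine Commute.pow_right ?_ p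
    have hz := zvec_mem_part (k := k) (m := m) (n := n) r
    rw [part_eq_homog] at hz
    have := mul_mul_X (k := k) _ hz t.1
    rwa [sgn_zero_left, one_smul] at this
  have := h1.sub_left h2
  rwa [add_sub_cancel_left] at this

variable (k m n) in
/-- The polynomials of degree at most `d`. -/
def wdeg (d : ℕ) : Submodule k (MvPolynomial (GenIndex m n) k) :=
  Submodule.span k {w | ∃ l : List (GenIndex m n), l.length ≤ d ∧
    w = (l.map MvPolynomial.X).prod}

theorem wdeg_mono {d d' : ℕ} (h : d ≤ d') : wdeg k m n d ≤ wdeg k m n d' :=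
  Submodule.span_mono fun _ ⟨l, hl, hs⟩ => ⟨l, hl.trans h, hs⟩

theorem prod_mem_wdeg {l : List (GenIndex m n)} {d : ℕ} (h : l.length ≤ d) :
    (l.map MvPolynomial.X).prod ∈ wdeg k m n d :=
  Submodule.subset_span ⟨l, h, rfl⟩

theorem X_mul_mem_wdeg (t : GenIndex m n) {d : ℕ} {w : MvPolynomial (GenIndex m n) k}
    (hw : w ∈ wdeg k m n d) : MvPolynomial.X t * w ∈ wdeg k m n (d + 1) := by
  induction hw using Submodule.span_induction with
  | mem w h =>
    obtain ⟨l, hl, rfl⟩ := h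
    exact Submodule.subset_span ⟨t :: l, by simpa using hl, by simp⟩
  | zero => simp
  | add x y _ _ hx hy => rw [mul_add]; exact add_mem hx hy
  | smul c x _ hx => rw [mul_smul_comm]; exact Submodule.smul_mem _ c hx

theorem exists_mem_wdeg (w : MvPolynomial (GenIndex m n) k) : ∃ d, w ∈ wdeg k m n d := by
  induction w using MvPolynomial.induction_on with
  | C c =>
    refine ⟨0, ?_⟩
    rw [← mul_one (MvPolynomial.C c), ← MvPolynomial.smul_eq_C_mul]
    exact Submodule.smul_mem _ c (prod_mem_wdeg (l := []) le_rfl)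
  | add f g hf hg =>
    obtain ⟨d, hd⟩ := hf
    obtain ⟨d', hd'⟩ := hg
    exact ⟨max d d', add_mem (wdeg_mono (le_max_left _ _) hd) (wdeg_mono (le_max_right _ _) hd')⟩
  | mul_X f t hf =>
    obtain ⟨d, hd⟩ := hf
    exact ⟨d + 1, by rw [mul_comm]; exact X_mul_mem_wdeg t hd⟩

theorem invLin_one : invLin k m n p 1 = vac := by
  rw [invLin_apply, map_one]; rfl

/-- The derivation given by a trace preserves the invariants and their degree. -/
theorem der_zvec_invLin (r : ℕ) {d : ℕ} {w : MvPolynomial (GenIndex m n) k}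
    (hw : w ∈ wdeg k m n d) : ∃ w' ∈ wdeg k m n d,
      der (basis k m n) (LinearMap.mulLeft k (zvec k m n r)) (invLin k m n p w) =
        invLin k m n p w' := by
  induction hw using Submodule.span_induction with
  | mem w h =>
    obtain ⟨l, hl, rfl⟩ := h
    suffices h : ∃ w' ∈ wdeg k m n l.length,
        der (basis k m n) (LinearMap.mulLeft k (zvec k m n r))
          (invLin k m n p (l.map MvPolynomial.X).prod) = invLin k m n p w' by
      obtain ⟨w', hw', h⟩ := h
      exact ⟨w', wdeg_mono hl hw', h⟩
    clear hl
    induction l with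
    | nil => exact ⟨0, zero_mem _, by simp [invLin_one]⟩
    | cons t l ih =>
      obtain ⟨w', hw', h⟩ := ih
      rw [List.map_cons, List.prod_cons, List.length_cons]
      rcases t with s | t
      -- By Leibniz, since the derivation of `z_r` sends `z_s` to `z_{r+s}`.
      · refine ⟨MvPolynomial.X (Sum.inl s) * w' +
          MvPolynomial.X (Sum.inl (r + s)) * (l.map MvPolynomial.X).prod,
          add_mem (X_mul_mem_wdeg _ hw') (X_mul_mem_wdeg _ (prod_mem_wdeg le_rfl)), ?_⟩
        have h1 := LinearMap.congr_fun (der_mul_mul_of_even (π := par m n)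
          (isHomog_mulLeft (zvec_mem_part (k := k) r)) (zvec k m n s))
          (invLin k m n p (l.map MvPolynomial.X).prod)
        simp only [Module.End.mul_apply, LinearMap.add_apply, LinearMap.mulLeft_apply,
          zvec_mul_zvec] at h1
        rw [← mul_zvec_invLin, h1, h, mul_zvec_invLin, mul_zvec_invLin, map_add]
      · refine ⟨MvPolynomial.X (Sum.inr t) * w', X_mul_mem_wdeg _ hw', ?_⟩
        have h1 := LinearMap.congr_fun (der_zvec_comm_X_pow (k := k) p r t).eq
          (invLin k m n p (l.map MvPolynomial.X).prod)
        simp only [Module.End.mul_apply] at h1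
        rw [← X_pow_invLin, h1, h, X_pow_invLin]
  | zero => exact ⟨0, zero_mem _, by simp⟩
  | add x y _ _ hx hy =>
    obtain ⟨x', hx', hx⟩ := hx
    obtain ⟨y', hy', hy⟩ := hy
    exact ⟨x' + y', add_mem hx' hy', by simp only [map_add, hx, hy]⟩
  | smul c x _ hx =>
    obtain ⟨x', hx', hx⟩ := hx
    exact ⟨c • x', Submodule.smul_mem _ c hx', by simp only [map_smul, hx]⟩

variable (k m n) in
/-- The symbols of the polynomials in the generators of the center. -/
def symbHom : MvPolynomial (GenIndex m n) k →ₗ[k] Fock k (par m n) :=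
  symb k m n ∘ₗ (genHom k m n p).toLinearMap

theorem symbHom_apply (w : MvPolynomial (GenIndex m n) k) :
    symbHom k m n p w = rep k m n (genHom k m n p w) vac := rfl

theorem symbHom_one : symbHom k m n p 1 = vac := by
  rw [symbHom_apply, map_one, map_one]; rfl

/-- The `p`-th power generators act as pure multiplications, and `z_r` adds only a derivation that
does not raise the degree. Degree here counts every generator as one, including the `p`-th powers.
-/
theorem symbHom_prod (l : List (GenIndex m n)) : ∀ d, l.length ≤ d + 1 →
    ∃ w' ∈ wdeg k m n d, symbHom k m n p (l.map MvPolynomial.X).prod =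
      invLin k m n p (l.map MvPolynomial.X).prod + invLin k m n p w' := by
  induction l with
  | nil => exact fun d _ => ⟨0, zero_mem _, by simp [symbHom_one, invLin_one]⟩
  | cons t l ih =>
    intro d hd
    have hl : l.length ≤ d := by simpa using hd
    -- The error term of the shorter product must survive multiplication by one more generator
    -- within degree `d`. For `d = 0` the shorter product is empty and the error is 0; otherwise the
    -- induction hypothesis is used one degree lower.
    obtain ⟨w', hw', hXw', h⟩ : ∃ w', w' ∈ wdeg k m n d ∧
        (∀ t, MvPolynomial.X t * w' ∈ wdeg k m n d) ∧
        symbHom k m n p (l.map MvPolynomial.X).prod =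
          invLin k m n p ((l.map MvPolynomial.X).prod + w') := by
      cases d with
      | zero =>
        have : l = [] := by simpa using hl
        subst this
        exact ⟨0, zero_mem _, by simp, by simp [symbHom_one, invLin_one]⟩
      | succ d =>
        obtain ⟨w', hw', h⟩ := ih d hl
        exact ⟨w', wdeg_mono (Nat.le_succ d) hw', fun t => X_mul_mem_wdeg t hw', by rw [h, map_add]⟩
    have h1 : symbHom k m n p ((t :: l).map MvPolynomial.X).prod =
        rep k m n (gen k m n p t) (invLin k m n p ((l.map MvPolynomial.X).prod + w')) := by
      rw [← h, List.map_cons, List.prod_cons, symbHom_apply, map_mul, map_mul, genHom_X]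
      rfl
    rw [h1, List.map_cons, List.prod_cons]
    rcases t with r | t
    · obtain ⟨v, hv, h2⟩ := der_zvec_invLin (k := k) p r (add_mem (prod_mem_wdeg hl) hw')
      refine ⟨MvPolynomial.X (Sum.inl r) * w' + v, add_mem (hXw' _) hv, ?_⟩
      change rep k m n (z k m n r) _ = _
      rw [rep_z, LinearMap.add_apply, mul_zvec_invLin, h2, mul_add, map_add, map_add]
      abel
    · refine ⟨MvPolynomial.X (Sum.inr t) * w', hXw' _, ?_⟩
      rw [rep_gen_inr, X_pow_invLin, mul_add, map_add]

theorem symbHom_injective_and_range (hmn : 0 < m + n) : Function.Injective (symbHom k m n p) ∧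
    LinearMap.range (symbHom k m n p) = LinearMap.range (invLin k m n p) := by
  refine injective_and_range_eq_of_triangular (wdeg k m n) exists_mem_wdeg ?_ ?_ ?_
  · exact (single_injective ∅).comp (invMap_injective k p m n hmn (Fact.out : p.Prime).ne_zero)
  · intro w hw
    induction hw using Submodule.span_induction with
    | mem w h =>
      obtain ⟨l, hl, rfl⟩ := h
      have : l = [] := by simpa using hl
      subst this
      simp [symbHom_one, invLin_one]
    | zero => simp
    | add x y _ _ hx hy => rw [map_add, map_add, hx, hy]
    | smul c x _ hx => rw [map_smul, map_smul, hx]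
  · intro d w hw
    induction hw using Submodule.span_induction with
    | mem w h =>
      obtain ⟨l, hl, rfl⟩ := h
      exact symbHom_prod p l d hl
    | zero => exact ⟨0, zero_mem _, by simp⟩
    | add x y _ _ hx hy =>
      obtain ⟨x', hx', hx⟩ := hx
      obtain ⟨y', hy', hy⟩ := hy
      exact ⟨x' + y', add_mem hx' hy', by simp only [map_add, hx, hy]; abel⟩
    | smul c x _ hx =>
      obtain ⟨x', hx', hx⟩ := hx
      exact ⟨c • x', Submodule.smul_mem _ c hx', by simp only [map_smul, hx, smul_add]⟩

theorem genHom_injective (hmn : 0 < m + n) : Function.Injective (genHom k m n p) := fun _ _ h =>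
  (symbHom_injective_and_range p hmn).1 (congrArg (symb k m n) h)

/-- The symbol of a central element is the symbol of some polynomial in the generators, and symbols
determine elements by PBW. As this holds in either parity, the odd part of the center lies in the
even part. -/
theorem centerPart_le_range_genHom (hmn : 0 < m + n) (a : ZMod 2) :
    centerPart k m n a ≤ Subalgebra.toSubmodule (genHom k m n p).range := by
  intro u hu
  obtain ⟨w, hw⟩ := symb_mem_range_of_mem_centerPart p hmn hu
  have h : symb k m n u ∈ LinearMap.range (symbHom k m n p) := by
    rw [(symbHom_injective_and_range p hmn).2]
    exact ⟨w, hw.symm⟩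
  obtain ⟨v, hv⟩ := h
  exact ⟨v, symb_injective hv⟩

theorem evenCenter_le : Subalgebra.toSubmodule (evenCenter k m n) ≤ center k m n :=
  le_sup_left (a := centerPart k m n 0)

theorem range_genHom (hmn : 0 < m + n) :
    Subalgebra.toSubmodule (genHom k m n p).range = center k m n := by
  refine le_antisymm ?_
    (sup_le (centerPart_le_range_genHom p hmn 0) (centerPart_le_range_genHom p hmn 1))
  refine le_trans ?_ evenCenter_le
  rintro _ ⟨w, rfl⟩
  exact genHom_mem_evenCenter p w

variable (k m n) in
/-- The center is generated by the `z_r` and the `p`-center. -/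
theorem center_eq_adjoin (hmn : 0 < m + n) : center k m n = Subalgebra.toSubmodule
    (Algebra.adjoin k (Set.range (z k m n) ∪ (pCenter k m n p : Set (U k m n)))) := by
  refine le_antisymm ?_ ?_
  · rw [← range_genHom p hmn]
    have h : ∀ w, genHom k m n p w ∈
        Algebra.adjoin k (Set.range (z k m n) ∪ (pCenter k m n p : Set (U k m n))) := by
      intro w
      induction w using MvPolynomial.induction_on with
      | C c =>
        rw [← MvPolynomial.algebraMap_eq, AlgHom.commutes]
        exact Subalgebra.algebraMap_mem _ c
      | add f g hf hg => rw [map_add]; exact add_mem hf hg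
      | mul_X f t hf =>
        rw [map_mul, genHom_X]
        refine mul_mem hf (Algebra.subset_adjoin ?_)
        rcases t with r | t
        · exact Or.inl ⟨r, rfl⟩
        · rw [gen_inr]
          exact Or.inr (Algebra.subset_adjoin ⟨_, basis_mem_part_zero t.2.1, rfl⟩)
    rintro _ ⟨w, rfl⟩
    exact h w
  · refine le_trans (Algebra.adjoin_le ?_ : _ ≤ evenCenter k m n) evenCenter_le
    rintro u (⟨r, rfl⟩ | hu)
    · exact z_mem_evenCenter r
    · have : pCenter k m n p ≤ evenCenter k m n := by
        refine Algebra.adjoin_le ?_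
        rintro _ ⟨y, hy, rfl⟩
        exact pow_sub_mem_evenCenter p hy
      exact this hu

end SuperCurrent

end

theorem mainTheorem3 (k : Type*) [Field k] [IsAlgClosed k] (p : ℕ) [Fact p.Prime] [CharP k p]
    (m n : ℕ) (hmn : 0 < m + n) :
    SuperCurrent.center k m n =
        Subalgebra.toSubmodule (Algebra.adjoin k
          (Set.range (SuperCurrent.z k m n) ∪
            (SuperCurrent.pCenter k m n p : Set (SuperCurrent.U k m n)))) ∧
      ∃ φ : MvPolynomial (SuperCurrent.GenIndex m n) k →ₐ[k] SuperCurrent.U k m n,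
        (∀ t, φ (MvPolynomial.X t) = SuperCurrent.gen k m n p t) ∧
          Function.Injective φ ∧
          Subalgebra.toSubmodule φ.range = SuperCurrent.center k m n := by
  exact ⟨SuperCurrent.center_eq_adjoin k m n p hmn, SuperCurrent.genHom k m n p,
    SuperCurrent.genHom_X p, SuperCurrent.genHom_injective p hmn,
    SuperCurrent.range_genHom p hmn⟩
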